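/- Let $X$ be a locally compact Hausdorff space and $\kappa:X\times X\to(-\infty,\infty]$ a kernel, that is, a symmetric lower semicontinuous function which is $\geqslant0$ unless $X$ is compact. For positive Radon measures $\mu,\nu$ on $X$ put $\kappa\mu(x):=\int\kappa(x,y)\,d\mu(y)$ and $\kappa(\mu,\nu):=\int\kappa\mu\,d\nu$, and let $\mathcal E^+$ be the cone of all positive Radon measures $\mu$ with $\|\mu\|^2:=\kappa(\mu,\mu)<\infty$. Assume that $\kappa$ is perfect: (1) the energy of every signed Radon measure is $\geqslant0$ whenever it is well defined; (2) $\mu\mapsto\|\mu\|:=\sqrt{\kappa(\mu,\mu)}$ is a norm on the space of signed Radon measures of finite energy (its topology is called strong); (3) every strong Cauchy net in $\mathcal E^+$ converges strongly to any of its vague limit points. For $A\subset X$, let $\mathcal E^+_A$ be the set of all $\mu\in\mathcal E^+$ concentrated on $A$ (that is, $X\setminus A$ is locally $\mu$-negligible), and let $$c_*(A):=\Bigl[\inf\bigl\{\kappa(\mu,\mu):\ \mu\in\mathcal E^+_A,\ \mu(X)=1\bigr\}\Bigr]^{-1}\in[0,\infty],\qquad c^*(A):=\inf\{c_*(D):\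 D\supset A\text{ open}\}$$ be its inner and outer capacity (with $\inf\varnothing=\infty$, $1/\infty=0$, $1/0=\infty$). A property holds nearly everywhere (n.e.) on $A$ if the set of all $x\in A$ where it fails has inner capacity $0$. The set $A$ is quasiclosed if $\inf\{c^*(A\bigtriangleup F):\ F\subset X\text{ closed}\}=0$. The inner capacitary measure $\gamma_A$ is the unique measure of minimum energy in $\Gamma^+_A:=\{\nu\in\mathcal E^+:\ \kappa\nu\geqslant1\text{ n.e. on }A\}$. Write $G(\nu):=2\nu(X)-\kappa(\nu,\nu)$ and $\widehat{\mathcal E}^+_A:=\{\nu\in\mathcal E^+_A:\ \kappa\nu\leqslant1\ \nu\text{-a.e.}\}$. Theorem. Let $A\subset X$ be a set with $c_*(A)<\infty$ such that $\mathcal E^+_A$ is strongly closed in $\mathcal E^+$, or in particular such that $A$ is quasiclosed. Then $\gamma_A$ exists and is unique, $\gamma_A\in\widehat{\mathcal E}^+_A\subset\mathcal E^+_A$, and $\gamma_A$ is the unique solution of each of the two extremal problems $$\max_{\nu\in\mathcal E^+_A}G(\nu)=G(\gamma_A)=c_*(A),\qquad \max_{\nu\in\widehat{\mathcal E}^+_A}\nu(X)=\gamma_A(X)=c_*(A).$$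 Furthermore, $\gamma_A$ is the only measure $\mu\in\mathcal E^+_A$ with (a), and the only measure $\mu\in\mathcal E^+_A$ with (b), where (a) $\mu(X)\geqslant\|\mu\|^2\geqslant c_*(A)$; (b) $\kappa\mu\geqslant1$ n.e. on $A$, and $\kappa\mu\leqslant1$ $\mu$-a.e. If moreover $\kappa$ satisfies Frostman's maximum principle (for every positive Radon measure $\mu$, if $\kappa\mu\leqslant1$ on the support of $\mu$, then $\kappa\mu\leqslant1$ on all of $X$), then $\gamma_A$ is the only measure $\mu\in\mathcal E^+_A$ with (c) $\kappa\mu=1$ n.e. on $A$. -/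

import Mathlib

open MeasureTheory Set Filter Topology
open scoped ENNReal CompactlySupported

noncomputable section

namespace PotentialTheory

variable {X : Type*} [TopologicalSpace X]

/-- A kernel on `X`: a symmetric lower semicontinuous function `X × X → (-∞, ∞]` which is
nonnegative unless `X` is compact. -/
structure IsKernel (κ : X → X → EReal) : Prop where
  bot_lt : ∀ x y, ⊥ < κ x y
  symm : ∀ x y, κ x y = κ y x
  lsc : LowerSemicontinuous (fun p : X × X => κ p.1 p.2)
  nonneg : ¬ CompactSpace X → ∀ x y, 0 ≤ κ x y

variable [MeasurableSpace X]

/-- The integral of an extended real valued function, `∫ f⁺ dμ - ∫ f⁻ dμ`. It is only applied to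
functions that are nonnegative, or bounded below with `μ` finite, so `∞ - ∞` does not occur. -/
def eintegral (μ : Measure X) (f : X → EReal) : EReal :=
  ((∫⁻ x, (f x).toENNReal ∂μ : ℝ≥0∞) : EReal) - ((∫⁻ x, (-f x).toENNReal ∂μ : ℝ≥0∞) : EReal)

/-- The potential `κμ(x) = ∫ κ(x, y) dμ(y)` of a positive measure. -/
def potential (κ : X → X → EReal) (μ : Measure X) (x : X) : EReal :=
  eintegral μ (fun y => κ x y)

/-- The mutual energy `κ(μ, ν) = ∫ κμ dν` of two positive Radon measures. The kernel being lower
semicontinuous, this iterated integral is the integral of `κ` against the Radon product of `μ`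
and `ν`. -/
def energy (κ : X → X → EReal) (μ ν : Measure X) : EReal :=
  eintegral ν (potential κ μ)

/-- The cone `ℰ⁺` of positive Radon measures of finite energy. Positive Radon measures on a locally
compact Hausdorff space are the regular Borel measures; their energy is never `-∞`. -/
def EPlus (κ : X → X → EReal) : Set (Measure X) :=
  {μ | μ.Regular ∧ energy κ μ μ < ⊤}

/-- `μ` is concentrated on `A`: the complement of `A` is locally `μ`-negligible. The set `A` is
arbitrary, and `μ` applied to a set is the outer measure of that set. -/
def ConcentratedOn (μ : Measure X) (A : Set X) : Prop :=
  ∀ K : Set X, IsCompact K → μ (Aᶜ ∩ K) = 0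

/-- The cone `ℰ⁺_A` of the measures in `ℰ⁺` that are concentrated on `A`. -/
def EPlusOn (κ : X → X → EReal) (A : Set X) : Set (Measure X) :=
  {μ | μ ∈ EPlus κ ∧ ConcentratedOn μ A}

/-- The class of the `ν ∈ ℰ⁺_A` with `κν ≤ 1` `ν`-a.e. on `X`. -/
def EHatOn (κ : X → X → EReal) (A : Set X) : Set (Measure X) :=
  {ν | ν ∈ EPlusOn κ A ∧ ∀ᵐ x ∂ν, potential κ ν x ≤ 1}

/-- `w(A)`: the infimum of the energy over the measures of total mass one in `ℰ⁺_A`. The energy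
of a positive measure is nonnegative for the kernels under consideration. -/
def minEnergy (κ : X → X → EReal) (A : Set X) : ℝ≥0∞ :=
  ⨅ μ ∈ {μ : Measure X | μ ∈ EPlusOn κ A ∧ μ univ = 1}, (energy κ μ μ).toENNReal

/-- The (Wiener) inner capacity `c_*(A) = 1 / w(A)`, with `1 / 0 = ∞` and `1 / ∞ = 0`. -/
def innerCap (κ : X → X → EReal) (A : Set X) : ℝ≥0∞ :=
  (minEnergy κ A)⁻¹

/-- The outer capacity `c^*(A)`: the infimum of `c_*(D)` over the open sets `D` containing `A`. -/
def outerCap (κ : X → X → EReal) (A : Set X) : ℝ≥0∞ :=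
  ⨅ D ∈ {D : Set X | IsOpen D ∧ A ⊆ D}, innerCap κ D

/-- `A` is quasiclosed: it can be approximated in outer capacity by closed sets. -/
def IsQuasiclosed (κ : X → X → EReal) (A : Set X) : Prop :=
  ⨅ F ∈ {F : Set X | IsClosed F}, outerCap κ (symmDiff A F) = 0

/-- `p` holds nearly everywhere on `A`: its exceptional set in `A` has inner capacity zero. -/
def NearlyEverywhereOn (κ : X → X → EReal) (A : Set X) (p : X → Prop) : Prop :=
  innerCap κ {x | x ∈ A ∧ ¬ p x} = 0

/-- The energy distance `‖μ - ν‖ = √(κ(μ, μ) + κ(ν, ν) - 2 κ(μ, ν))` between measures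
`μ, ν ∈ ℰ⁺`. -/
def strongDist (κ : X → X → EReal) (μ ν : Measure X) : ℝ :=
  √((energy κ μ μ).toReal + (energy κ ν ν).toReal - 2 * (energy κ μ ν).toReal)

/-- Positive definiteness: every signed Radon measure has nonnegative energy whenever its energy
is well defined. A signed Radon measure is a difference `μ - ν` of two positive ones, and its energy
is `κ(μ, μ) + κ(ν, ν) - 2 κ(μ, ν)`. -/
def IsPositiveDefinite (κ : X → X → EReal) : Prop :=
  ∀ μ ν : Measure X, μ.Regular → ν.Regular →
    2 * energy κ μ ν ≤ energy κ μ μ + energy κ ν ν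

/-- The energy principle: the energy seminorm is a norm on the space of signed Radon measures of
finite energy, which are the differences `μ - ν` with `μ, ν ∈ ℰ⁺`. -/
def EnergyPrinciple (κ : X → X → EReal) : Prop :=
  ∀ μ ∈ EPlus κ, ∀ ν ∈ EPlus κ, strongDist κ μ ν = 0 → μ = ν

/-- The vague topology: pointwise convergence on the continuous functions of compact support. -/
abbrev vagueTopology (X : Type*) [TopologicalSpace X] [MeasurableSpace X] :
    TopologicalSpace (Measure X) :=
  TopologicalSpace.induced (fun (μ : Measure X) (f : C_c(X, ℝ)) => ∫ x, f x ∂μ) inferInstance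

/-- Consistency: every strong Cauchy net in `ℰ⁺` converges strongly to any of its vague limit
points. Nets are expressed by filters. -/
def IsConsistent (κ : X → X → EReal) : Prop :=
  ∀ l : Filter (Measure X), l.NeBot → EPlus κ ∈ l →
    (∀ ε : ℝ, 0 < ε → ∃ S ∈ l, ∀ μ ∈ S, ∀ ν ∈ S, strongDist κ μ ν < ε) →
    ∀ μ : Measure X, μ.Regular → @ClusterPt _ (vagueTopology X) μ l →
      μ ∈ EPlus κ ∧ Tendsto (fun ν => strongDist κ ν μ) l (𝓝 0)

/-- A perfect kernel: positive definite, with the energy and the consistency principles. -/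
structure IsPerfect (κ : X → X → EReal) : Prop where
  isKernel : IsKernel κ
  positiveDefinite : IsPositiveDefinite κ
  energyPrinciple : EnergyPrinciple κ
  consistent : IsConsistent κ

/-- Frostman's maximum principle: if `κμ ≤ 1` on the support of a positive Radon measure `μ`, then
`κμ ≤ 1` on all of `X`. -/
def FrostmanPrinciple (κ : X → X → EReal) : Prop :=
  ∀ μ : Measure X, μ.Regular → (∀ x ∈ μ.support, potential κ μ x ≤ 1) →
    ∀ x, potential κ μ x ≤ 1

/-- A set of measures is strongly closed: it is closed in `ℰ⁺` for the energy distance. -/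
def IsStronglyClosed (κ : X → X → EReal) (S : Set (Measure X)) : Prop :=
  ∀ μ ∈ EPlus κ, (∀ ε : ℝ, 0 < ε → ∃ ν ∈ S, strongDist κ μ ν < ε) → μ ∈ S

/-- The class `Γ⁺_A` of the `ν ∈ ℰ⁺` with `κν ≥ 1` n.e. on `A`. -/
def GammaPlus (κ : X → X → EReal) (A : Set X) : Set (Measure X) :=
  {ν | ν ∈ EPlus κ ∧ NearlyEverywhereOn κ A (fun x => 1 ≤ potential κ ν x)}

/-- `γ` is an inner capacitary measure of `A`: it has minimum energy in `Γ⁺_A`. -/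
def IsInnerCapacitaryMeasure (κ : X → X → EReal) (A : Set X) (γ : Measure X) : Prop :=
  γ ∈ GammaPlus κ A ∧ IsMinOn (fun ν => energy κ ν ν) (GammaPlus κ A) γ

/-- The Gauss functional `G(μ) = 2 μ(X) - κ(μ, μ)`. -/
def gaussG (κ : X → X → EReal) (μ : Measure X) : EReal :=
  2 * ((μ univ : ℝ≥0∞) : EReal) - energy κ μ μ

end PotentialTheory

end

open PotentialTheory

/-! Write `c` for the inner capacity of `A`. Everything rests on one measure `γ` concentrated on `A`
with `κγ ≥ 1` n.e. on `A` and `γ(X) = ‖γ‖² = c`. Measures in `EPlusOn κ A` do not charge the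
exceptional set, so integrating `κγ ≥ 1` gives `ν(X) ≤ κ(γ, ν)`, that is `G(ν) ≤ c - ‖ν - γ‖²`, for
all these `ν`. Integrating `κν ≥ 1` against `γ` gives `‖ν‖² ≥ c + ‖ν - γ‖²` for `ν` in `GammaPlus κ
A`. The energy principle turns equality into `ν = γ`, and maximality of the mass, (a), (b) and (c)
each force `G(ν) ≥ c`.

To find `γ` when the minimal energy `w` is finite, take unit measures on `A` whose energies tend to
`w`. The parallelogram law makes them strongly Cauchy. Bounded mass gives a vague limit along an
ultrafilter, which consistency makes a strong limit `ρ` (`exists_strong_limit`); strong closedness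
puts `ρ` on `A`, with energy `w`. The delicate point is that `ρ` still has mass one
(`one_le_real_univ_of_tendsto`): on noncompact `X`, mass lost at infinity would carry energy at
least `w` times its square, whereas the energy of `ρ` is almost entirely seen on a compact set. Then
`γ = c ρ`, and varying `ρ` in the directions `ν` gives `κγ ≥ 1` n.e. (`exists_equilibrium`). For
quasiclosed `A`, strong closedness holds because bounded energy forces little mass on open sets of
small capacity.

Measures need not be `σ`-finite, so symmetry of the energy comes from `τ`-additivity of Radon
measures; possible negativity of `κ` is removed by adding a constant on compact `X`. -/

noncomputable section

open scoped NNReal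

namespace PotentialTheory

/-! ### Sums of Radon measures and `τ`-additivity -/

section TauAdditivity

variable {X : Type*} [TopologicalSpace X] [MeasurableSpace X]

theorem regular_add [R1Space X] {μ ν : Measure X}
    (hμ : μ.Regular) (hν : ν.Regular) : (μ + ν).Regular := by
  have h1 : IsFiniteMeasureOnCompacts (μ + ν) :=
    ⟨fun K hK => by
      simpa using ⟨hK.measure_lt_top (μ := μ), hK.measure_lt_top (μ := ν)⟩⟩
  have h2 : (μ + ν).OuterRegular := by
    refine ⟨fun A _ r hr => ?_⟩
    have hμA : μ A ≠ ⊤ := fun h => by simp [h] at hr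
    have hνA : ν A ≠ ⊤ := fun h => by simp [h] at hr
    obtain ⟨ε, hε, hεr⟩ : ∃ ε : ℝ≥0∞, 0 < ε ∧ μ A + ν A + ε < r := by
      obtain ⟨s, hs, hsr⟩ := exists_between hr
      refine ⟨s - (μ A + ν A), tsub_pos_of_lt hs, ?_⟩
      rwa [← Measure.add_apply, add_tsub_cancel_of_le hs.le]
    have hε2 : ε / 2 ≠ 0 := (ENNReal.half_pos hε.ne').ne'
    obtain ⟨U, hAU, hU, hUr⟩ := A.exists_isOpen_le_add μ hε2
    obtain ⟨V, hAV, hV, hVr⟩ := A.exists_isOpen_le_add ν hε2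
    refine ⟨U ∩ V, subset_inter hAU hAV, hU.inter hV, lt_of_le_of_lt ?_ hεr⟩
    calc (μ + ν) (U ∩ V) ≤ μ U + ν V := by
          simpa using add_le_add (measure_mono inter_subset_left) (measure_mono inter_subset_right)
      _ ≤ (μ A + ε / 2) + (ν A + ε / 2) := add_le_add hUr hVr
      _ = μ A + ν A + ε := by rw [add_add_add_comm, ENNReal.add_halves]
  refine ⟨fun U hU r hr => ?_⟩
  rw [Measure.add_apply] at hr
  by_contra! hcon
  refine hr.not_ge ?_
  rw [hU.measure_eq_iSup_isCompact μ, hU.measure_eq_iSup_isCompact ν]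
  simp only [iSup_and']
  refine ENNReal.biSup_add_biSup_le' ⟨∅, empty_subset _, isCompact_empty⟩
    ⟨∅, empty_subset _, isCompact_empty⟩ fun K hK L hL => ?_
  refine le_trans ?_ (hcon (K ∪ L) (union_subset hK.1 hL.1) (hK.2.union hL.2))
  simpa using add_le_add (measure_mono subset_union_left) (measure_mono subset_union_right)

/-- A compact subset of a directed union of open sets already lies in one of them, and compact sets
exhaust the measure of the union. -/
theorem measure_iUnion_eq_iSup_of_directed_isOpen {ι : Type*} [Nonempty ι] (μ : Measure X)
    [μ.Regular] {U : ι → Set X} (hU : ∀ i, IsOpen (U i)) (hd : Directed (· ⊆ ·) U) :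
    μ (⋃ i, U i) = ⨆ i, μ (U i) := by
  refine le_antisymm (le_of_forall_lt fun a ha => ?_) (iSup_le fun i => measure_mono
    (subset_iUnion U i))
  obtain ⟨K, hKU, hK, haK⟩ := (isOpen_iUnion hU).exists_lt_isCompact ha
  obtain ⟨i, hi⟩ := hK.elim_directed_cover U hU hKU hd
  exact haK.trans_le ((measure_mono hi).trans (le_iSup (fun i => μ (U i)) i))

/-- The staircase function of step `ε` with `N` stairs, below the identity. -/
def stairs (ε : ℝ≥0∞) (N : ℕ) (t : ℝ≥0∞) : ℝ≥0∞ :=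
  ∑ j ∈ Finset.range N, if (j + 1 : ℕ) * ε < t then ε else 0

theorem stairs_le (ε : ℝ≥0∞) (N : ℕ) (t : ℝ≥0∞) : stairs ε N t ≤ t := by
  suffices h : stairs ε N t ≤ t ∧ stairs ε N t ≤ N * ε from h.1
  induction N with
  | zero => simp [stairs]
  | succ N ih =>
    have hs : stairs ε (N + 1) t = stairs ε N t + if (N + 1 : ℕ) * ε < t then ε else 0 := by
      rw [stairs, Finset.sum_range_succ]; rfl
    have h2 : stairs ε N t + ε ≤ (N + 1 : ℕ) * ε := by
      push_cast
      rw [add_mul, one_mul]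
      gcongr
      exact ih.2
    split_ifs at hs with h
    · rw [hs]; exact ⟨h2.trans h.le, h2⟩
    · rw [hs, add_zero]; exact ⟨ih.1, le_self_add.trans h2⟩

theorem mul_le_stairs {ε : ℝ≥0∞} {M N : ℕ} {t : ℝ≥0∞} (hMN : M ≤ N) (h : M * ε < t) :
    M * ε ≤ stairs ε N t := by
  calc (M : ℝ≥0∞) * ε = ∑ _j ∈ Finset.range M, ε := by simp
    _ = ∑ j ∈ Finset.range M, if (j + 1 : ℕ) * ε < t then ε else 0 := by
        refine Finset.sum_congr rfl fun j hj => ?_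
        rw [if_pos]
        refine lt_of_le_of_lt ?_ h
        gcongr
        exact Finset.mem_range.1 hj
    _ ≤ stairs ε N t := Finset.sum_le_sum_of_subset (Finset.range_mono hMN)

theorem le_liminf_stairs (t : ℝ≥0∞) :
    t ≤ liminf (fun n : ℕ => stairs ((n + 1 : ℝ≥0)⁻¹ : ℝ≥0) ((n + 1) * (n + 1)) t) atTop := by
  refine le_of_forall_lt fun a ha => ?_
  obtain ⟨b, hab, hbt⟩ := ENNReal.lt_iff_exists_nnreal_btwn.1 ha
  lift a to ℝ≥0 using ha.ne_top
  obtain ⟨c, hac, hcb⟩ := exists_between (ENNReal.coe_lt_coe.1 hab)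
  refine lt_of_lt_of_le (ENNReal.coe_lt_coe.2 hac) ?_
  refine le_liminf_of_le (by isBoundedDefault) ?_
  have h1 : ∀ᶠ n : ℕ in atTop, b ≤ n := by
    obtain ⟨m, hm⟩ := exists_nat_ge b
    filter_upwards [eventually_ge_atTop m] with n hn
    exact hm.trans (by exact_mod_cast hn)
  have h2 : ∀ᶠ n : ℕ in atTop, (n + 1 : ℝ≥0)⁻¹ < b - c := by
    obtain ⟨m, hm⟩ := exists_nat_one_div_lt (tsub_pos_of_lt hcb : 0 < b - c)
    filter_upwards [eventually_ge_atTop m] with n hn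
    refine lt_of_le_of_lt ?_ hm
    rw [one_div]
    gcongr
  filter_upwards [h1, h2] with n hn1 hn2
  have hpos : (0 : ℝ≥0) < n + 1 := by positivity
  -- With step `1/(n+1)`, `M` is the number of stairs not exceeding `b`. It loses less than one
  -- step, which is smaller than `b - c`.
  set M := ⌊b * (n + 1)⌋₊ with hM
  have hMb : (M : ℝ≥0) * (n + 1 : ℝ≥0)⁻¹ ≤ b := by
    rw [← div_eq_mul_inv, div_le_iff₀ hpos]
    exact Nat.floor_le (by positivity)
  have hMN : M ≤ (n + 1) * (n + 1) := by
    have : (M : ℝ≥0) ≤ ((n + 1) * (n + 1) : ℕ) := by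
      refine (Nat.floor_le (by positivity)).trans ?_
      push_cast
      gcongr
      exact hn1.trans (by simp)
    exact_mod_cast this
  have hcM : c ≤ M * (n + 1 : ℝ≥0)⁻¹ := by
    have h3 : b * (n + 1) < M + 1 := Nat.lt_floor_add_one _
    have h4 : b < M * (n + 1 : ℝ≥0)⁻¹ + (n + 1 : ℝ≥0)⁻¹ := by
      rw [← add_one_mul, ← div_eq_mul_inv, lt_div_iff₀ hpos]
      exact h3
    have h5 : c + (n + 1 : ℝ≥0)⁻¹ < b := by
      rw [lt_tsub_iff_left] at hn2
      exact hn2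
    exact (lt_of_add_lt_add_right (h5.trans h4)).le
  have key := mul_le_stairs (ε := ((n + 1 : ℝ≥0)⁻¹ : ℝ≥0)) (t := t) hMN
    (lt_of_le_of_lt (by exact_mod_cast hMb) hbt)
  exact le_trans (by exact_mod_cast hcM) key

theorem lintegral_stairs [OpensMeasurableSpace X] (μ : Measure X) {f : X → ℝ≥0∞}
    (hf : LowerSemicontinuous f) (ε : ℝ≥0∞) (N : ℕ) :
    ∫⁻ x, stairs ε N (f x) ∂μ = ∑ j ∈ Finset.range N, ε * μ {x | (j + 1 : ℕ) * ε < f x} := by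
  unfold stairs
  have hm : ∀ j : ℕ, MeasurableSet {x | (j + 1 : ℕ) * ε < f x} := fun j =>
    (hf.isOpen_preimage _).measurableSet
  have hi : ∀ j : ℕ, (fun x => if (j + 1 : ℕ) * ε < f x then ε else 0) =
      {x | (j + 1 : ℕ) * ε < f x}.indicator fun _ => ε := fun j => by
    ext x; simp [indicator_apply]
  rw [lintegral_finsetSum]
  · refine Finset.sum_congr rfl fun j _ => ?_
    rw [hi, lintegral_indicator_const (hm j)]
  · intro j _
    rw [hi]
    exact measurable_const.indicator (hm j)

/-- Regular measures are `τ`-additive: the integral commutes with directed suprema of lower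
semicontinuous functions. -/
theorem lintegral_iSup_of_directed_lsc [OpensMeasurableSpace X] {ι : Type*} [Nonempty ι]
    (μ : Measure X) [μ.Regular] {f : ι → X → ℝ≥0∞} (hf : ∀ i, LowerSemicontinuous (f i))
    (hd : Directed (· ≤ ·) f) : ∫⁻ x, ⨆ i, f i x ∂μ = ⨆ i, ∫⁻ x, f i x ∂μ := by
  refine le_antisymm ?_ (iSup_le fun i => lintegral_mono fun x => le_iSup (fun i => f i x) i)
  have hF : LowerSemicontinuous fun x => ⨆ i, f i x := lowerSemicontinuous_iSup hf
  have hbound : ∀ (ε : ℝ≥0∞) (N : ℕ),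
      ∫⁻ x, stairs ε N (⨆ i, f i x) ∂μ ≤ ⨆ i, ∫⁻ x, f i x ∂μ := by
    intro ε N
    rw [lintegral_stairs μ hF]
    -- A staircase integral is a finite sum of measures of open superlevel sets, and those of the
    -- supremum are directed unions.
    have hU : ∀ c : ℝ≥0∞, μ {x | c < ⨆ i, f i x} = ⨆ i, μ {x | c < f i x} := by
      intro c
      rw [← measure_iUnion_eq_iSup_of_directed_isOpen μ (U := fun i => {x | c < f i x})
        (fun i => (hf i).isOpen_preimage c)]
      · congr 1
        ext x
        simp [lt_iSup_iff]
      · intro i j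
        obtain ⟨k, hik, hjk⟩ := hd i j
        exact ⟨k, fun x hx => lt_of_lt_of_le hx (hik x), fun x hx => lt_of_lt_of_le hx (hjk x)⟩
    simp_rw [hU, ENNReal.mul_iSup]
    rw [ENNReal.finsetSum_iSup]
    · refine iSup_mono fun i => ?_
      rw [← lintegral_stairs μ (hf i)]
      exact lintegral_mono fun x => stairs_le _ _ _
    · intro i j
      obtain ⟨k, hik, hjk⟩ := hd i j
      refine ⟨k, fun a => ⟨?_, ?_⟩⟩
      · gcongr with x; exact hik x
      · gcongr with x; exact hjk x
  -- Fatou's lemma along ever finer and taller staircases recovers the full integral.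
  calc ∫⁻ x, ⨆ i, f i x ∂μ
      ≤ ∫⁻ x, liminf (fun n : ℕ => stairs ((n + 1 : ℝ≥0)⁻¹ : ℝ≥0) ((n + 1) * (n + 1))
          (⨆ i, f i x)) atTop ∂μ := lintegral_mono fun x => le_liminf_stairs _
    _ ≤ liminf (fun n : ℕ => ∫⁻ x, stairs ((n + 1 : ℝ≥0)⁻¹ : ℝ≥0) ((n + 1) * (n + 1))
          (⨆ i, f i x) ∂μ) atTop := by
        refine lintegral_liminf_le fun n => ?_
        unfold stairs
        refine Finset.measurable_fun_sum _ fun j _ => ?_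
        exact Measurable.ite (hF.isOpen_preimage _).measurableSet measurable_const measurable_const
    _ ≤ ⨆ i, ∫⁻ x, f i x ∂μ :=
        liminf_le_of_le (by isBoundedDefault) fun b hb => by
          obtain ⟨n, hn⟩ := hb.exists
          exact hn.trans (hbound _ _)

end TauAdditivity

/-! ### Tonelli's theorem for lower semicontinuous kernels -/

section Tonelli

/-- The nonnegative continuous functions of compact support below a given function. -/
abbrev CcMinorant {Y : Type*} [TopologicalSpace Y] (f : Y → ℝ≥0∞) : Type _ :=
  {φ : C(Y, ℝ) // HasCompactSupport φ ∧ (∀ y, 0 ≤ φ y) ∧ ∀ y, ENNReal.ofReal (φ y) ≤ f y}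

namespace CcMinorant

variable {Y : Type*} [TopologicalSpace Y] {f : Y → ℝ≥0∞}

instance : Nonempty (CcMinorant f) :=
  ⟨⟨0, HasCompactSupport.zero, by simp, by simp⟩⟩

theorem directed [T2Space Y] (f : Y → ℝ≥0∞) :
    Directed (· ≤ ·) fun (φ : CcMinorant f) (y : Y) => ENNReal.ofReal (φ.1 y) := by
  rintro ⟨φ, hφ, hφ0, hφf⟩ ⟨ψ, hψ, hψ0, hψf⟩
  refine ⟨⟨φ ⊔ ψ, ?_, fun y => le_max_of_le_left (hφ0 y), fun y => ?_⟩, fun y => ?_, fun y => ?_⟩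
  · refine HasCompactSupport.of_support_subset_isCompact (hφ.isCompact.union hψ.isCompact) ?_
    intro y hy
    by_contra hcon
    rw [mem_union, not_or] at hcon
    refine hy ?_
    simp [image_eq_zero_of_notMem_tsupport hcon.1, image_eq_zero_of_notMem_tsupport hcon.2]
  · rw [ContinuousMap.sup_apply, ENNReal.ofReal_max]
    exact max_le (hφf y) (hψf y)
  · exact ENNReal.ofReal_le_ofReal (le_max_left _ _)
  · exact ENNReal.ofReal_le_ofReal (le_max_right _ _)

/-- For `b < f y`, Urysohn gives a bump function supported in the open set `{f > b}` and equal to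
`1` at `y`; its multiple by `b` is a minorant. -/
theorem iSup_eq [T2Space Y] [LocallyCompactSpace Y] (hf : LowerSemicontinuous f) (y : Y) :
    ⨆ φ : CcMinorant f, ENNReal.ofReal (φ.1 y) = f y := by
  refine le_antisymm (iSup_le fun φ => φ.2.2.2 y) (le_of_forall_lt fun a ha => ?_)
  obtain ⟨b, hab, hbf⟩ := ENNReal.lt_iff_exists_nnreal_btwn.1 ha
  obtain ⟨g, hg1, hgc, hgU, hg01⟩ := exists_continuousMap_one_of_isCompact_subset_isOpen
    isCompact_singleton (hf.isOpen_preimage b) (singleton_subset_iff.2 hbf)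
  have hgy : g y = 1 := hg1 rfl
  refine hab.trans_le (le_iSup_of_le ⟨(b : ℝ) • g, ?_, fun z => ?_, fun z => ?_⟩ ?_)
  · exact HasCompactSupport.smul_left (f := fun _ => (b : ℝ)) hgc
  · exact mul_nonneg b.2 (hg01 z).1
  · by_cases hz : z ∈ tsupport g
    · refine le_trans ?_ (hgU hz : (b : ℝ≥0∞) < f z).le
      rw [← ENNReal.ofReal_coe_nnreal]
      exact ENNReal.ofReal_le_ofReal (mul_le_of_le_one_right b.2 (hg01 z).2)
    · simp [image_eq_zero_of_notMem_tsupport hz]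
  · simp [hgy]

end CcMinorant

variable {X : Type*} [TopologicalSpace X]

theorem hasCompactSupport_section [T2Space X] {φ : C(X × X, ℝ)} (hφ : HasCompactSupport φ) (x : X) :
    HasCompactSupport fun y => φ (x, y) := by
  refine HasCompactSupport.of_support_subset_isCompact (hφ.isCompact.image continuous_snd) ?_
  intro y hy
  exact ⟨(x, y), subset_tsupport _ hy, rfl⟩

variable [MeasurableSpace X]

theorem lintegral_ofReal_eq_of_hasCompactSupport [OpensMeasurableSpace X] (μ : Measure X) [IsFiniteMeasureOnCompacts μ]
    {f : X → ℝ} (hf : Continuous f) (hfc : HasCompactSupport f) (hf0 : ∀ x, 0 ≤ f x) :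
    ∫⁻ x, ENNReal.ofReal (f x) ∂μ = ENNReal.ofReal (∫ x, f x ∂μ) :=
  (ofReal_integral_eq_lintegral_ofReal (hf.integrable_of_hasCompactSupport hfc)
    (Eventually.of_forall hf0)).symm

theorem continuous_integral_section [OpensMeasurableSpace X] (μ : Measure X) [IsFiniteMeasureOnCompacts μ]
    {φ : C(X × X, ℝ)} (hφ : HasCompactSupport φ) : Continuous fun x => ∫ y, φ (x, y) ∂μ := by
  rw [← continuousOn_univ]
  refine continuousOn_integral_of_compact_support (hφ.isCompact.image continuous_snd)
    φ.continuous.continuousOn fun x y _ hy => ?_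
  by_contra hne
  exact hy ⟨(x, y), subset_tsupport _ hne, rfl⟩

theorem hasCompactSupport_integral_section [T2Space X] (μ : Measure X)
    {φ : C(X × X, ℝ)} (hφ : HasCompactSupport φ) :
    HasCompactSupport fun x => ∫ y, φ (x, y) ∂μ := by
  refine HasCompactSupport.of_support_subset_isCompact (hφ.isCompact.image continuous_fst) ?_
  intro x hx
  by_contra hcon
  refine hx ?_
  have : ∀ y, φ (x, y) = 0 := fun y => by
    by_contra hne
    exact hcon ⟨(x, y), subset_tsupport _ hne, rfl⟩
  simp [this]

variable [LocallyCompactSpace X] [T2Space X] [BorelSpace X]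

theorem lintegral_eq_iSup_integral_section (μ : Measure X) [μ.Regular] {k : X → X → ℝ≥0∞}
    (hk : LowerSemicontinuous fun p : X × X => k p.1 p.2) (x : X) :
    ∫⁻ y, k x y ∂μ = ⨆ φ : CcMinorant (fun p : X × X => k p.1 p.2),
      ENNReal.ofReal (∫ y, φ.1 (x, y) ∂μ) := by
  calc ∫⁻ y, k x y ∂μ = ∫⁻ y, ⨆ φ : CcMinorant (fun p : X × X => k p.1 p.2),
        ENNReal.ofReal (φ.1 (x, y)) ∂μ :=
        lintegral_congr fun y => (CcMinorant.iSup_eq hk (x, y)).symm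
    _ = ⨆ φ : CcMinorant (fun p : X × X => k p.1 p.2), ∫⁻ y, ENNReal.ofReal (φ.1 (x, y)) ∂μ := by
        refine lintegral_iSup_of_directed_lsc μ (fun φ => ?_) fun φ ψ => ?_
        · refine Continuous.lowerSemicontinuous ?_
          exact ENNReal.continuous_ofReal.comp (φ.1.continuous.comp (by fun_prop))
        · obtain ⟨χ, h1, h2⟩ := CcMinorant.directed (fun p : X × X => k p.1 p.2) φ ψ
          exact ⟨χ, fun y => h1 (x, y), fun y => h2 (x, y)⟩
    _ = _ := by
        refine iSup_congr fun φ => ?_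
        exact lintegral_ofReal_eq_of_hasCompactSupport μ (φ.1.continuous.comp (by fun_prop))
          (hasCompactSupport_section φ.2.1 x) fun y => φ.2.2.1 _

/-- The potential of a regular measure with respect to a nonnegative lower semicontinuous kernel
is lower semicontinuous. -/
theorem lowerSemicontinuous_lintegral_section (μ : Measure X) [μ.Regular] {k : X → X → ℝ≥0∞}
    (hk : LowerSemicontinuous fun p : X × X => k p.1 p.2) :
    LowerSemicontinuous fun x => ∫⁻ y, k x y ∂μ := by
  simp_rw [lintegral_eq_iSup_integral_section μ hk]
  exact lowerSemicontinuous_iSup fun φ =>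
    (ENNReal.continuous_ofReal.comp (continuous_integral_section μ φ.2.1)).lowerSemicontinuous

/-- Two applications of `τ`-additivity reduce the iterated integral to continuous functions of
compact support, for which the order of integration is irrelevant without `σ`-finiteness. -/
theorem lintegral_lintegral_eq_iSup (μ ν : Measure X) [μ.Regular] [ν.Regular]
    {k : X → X → ℝ≥0∞} (hk : LowerSemicontinuous fun p : X × X => k p.1 p.2) :
    ∫⁻ x, ∫⁻ y, k x y ∂μ ∂ν = ⨆ φ : CcMinorant (fun p : X × X => k p.1 p.2),
      ENNReal.ofReal (∫ x, ∫ y, φ.1 (x, y) ∂μ ∂ν) := by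
  simp_rw [lintegral_eq_iSup_integral_section μ hk]
  rw [lintegral_iSup_of_directed_lsc ν]
  · refine iSup_congr fun φ => ?_
    exact lintegral_ofReal_eq_of_hasCompactSupport ν (continuous_integral_section μ φ.2.1)
      (hasCompactSupport_integral_section μ φ.2.1)
      fun x => integral_nonneg fun y => φ.2.2.1 _
  · exact fun φ =>
      (ENNReal.continuous_ofReal.comp (continuous_integral_section μ φ.2.1)).lowerSemicontinuous
  · intro φ ψ
    obtain ⟨χ, h1, h2⟩ := CcMinorant.directed (fun p : X × X => k p.1 p.2) φ ψ
    have key : ∀ φ' : CcMinorant (fun p : X × X => k p.1 p.2),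
        (∀ p, ENNReal.ofReal (φ'.1 p) ≤ ENNReal.ofReal (χ.1 p)) → ∀ x,
        ENNReal.ofReal (∫ y, φ'.1 (x, y) ∂μ) ≤ ENNReal.ofReal (∫ y, χ.1 (x, y) ∂μ) := by
      intro φ' h x
      rw [← lintegral_ofReal_eq_of_hasCompactSupport μ (f := fun y => φ'.1 (x, y)) (by fun_prop)
          (hasCompactSupport_section φ'.2.1 x) fun y => φ'.2.2.1 _,
        ← lintegral_ofReal_eq_of_hasCompactSupport μ (f := fun y => χ.1 (x, y)) (by fun_prop)
          (hasCompactSupport_section χ.2.1 x) fun y => χ.2.2.1 _]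
      exact lintegral_mono fun y => h (x, y)
    exact ⟨χ, key φ h1, key ψ h2⟩

/-- Tonelli's theorem for lower semicontinuous kernels and regular measures, which need not be
`σ`-finite. -/
theorem lintegral_lintegral_swap_of_lsc (μ ν : Measure X) [μ.Regular] [ν.Regular]
    {k : X → X → ℝ≥0∞} (hk : LowerSemicontinuous fun p : X × X => k p.1 p.2)
    (hsymm : ∀ x y, k x y = k y x) :
    ∫⁻ x, ∫⁻ y, k x y ∂μ ∂ν = ∫⁻ x, ∫⁻ y, k x y ∂ν ∂μ := by
  suffices h : ∀ (μ ν : Measure X) [μ.Regular] [ν.Regular],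
      ∫⁻ x, ∫⁻ y, k x y ∂μ ∂ν ≤ ∫⁻ x, ∫⁻ y, k x y ∂ν ∂μ from le_antisymm (h μ ν) (h ν μ)
  intro μ ν _ _
  rw [lintegral_lintegral_eq_iSup μ ν hk, lintegral_lintegral_eq_iSup ν μ hk]
  refine iSup_le fun φ => ?_
  let ψ : C(X × X, ℝ) := φ.1.comp ⟨Prod.swap, continuous_swap⟩
  have hψ : HasCompactSupport ψ :=
    φ.2.1.comp_homeomorph (Homeomorph.prodComm X X)
  refine le_iSup_of_le ⟨ψ, hψ, fun p => φ.2.2.1 _, fun p => ?_⟩ (le_of_eq ?_)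
  · exact (φ.2.2.2 p.swap).trans (hsymm _ _).le
  · congr 1
    exact integral_integral_swap_of_hasCompactSupport (f := fun x y => φ.1 (x, y))
      φ.1.continuous φ.2.1

end Tonelli

/-! ### Reduction to a nonnegative kernel -/

section Shift

variable {X : Type*} [TopologicalSpace X]

/-- The kernel `κ` is the difference of a nonnegative kernel `k` and a constant `C`, which vanishes
unless `X` is compact. -/
structure IsShift (κ : X → X → EReal) (k : X → X → ℝ≥0∞) (C : ℝ≥0) : Prop where
  eq : ∀ x y, κ x y = (k x y : EReal) - ((C : ℝ≥0∞) : EReal)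
  symm : ∀ x y, k x y = k y x
  lsc : LowerSemicontinuous fun p : X × X => k p.1 p.2
  compact : C = 0 ∨ CompactSpace X

theorem continuous_add_const_of_finite {c : EReal} (h1 : c ≠ ⊥) (h2 : c ≠ ⊤) :
    Continuous fun z : EReal => z + c :=
  continuous_iff_continuousAt.2 fun z =>
    ContinuousAt.comp (f := fun z : EReal => (z, c)) (g := fun p : EReal × EReal => p.1 + p.2)
      (EReal.continuousAt_add (p := (z, c)) (.inr h1) (.inr h2)) (by fun_prop)

theorem continuous_sub_const_of_finite {c : ℝ≥0∞} (hc : c ≠ ⊤) :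
    Continuous fun z : ℝ≥0∞ => (z : EReal) - (c : EReal) := by
  simp_rw [sub_eq_add_neg]
  refine (continuous_add_const_of_finite ?_ ?_).comp continuous_coe_ennreal_ereal
  · simpa using hc
  · simp

theorem IsKernel.exists_le {κ : X → X → EReal} (hκ : IsKernel κ) [CompactSpace X] :
    ∃ C : ℝ≥0, ∀ x y, -((C : ℝ≥0∞) : EReal) ≤ κ x y := by
  rcases isEmpty_or_nonempty X with hX | hX
  · exact ⟨0, fun x => hX.elim x⟩
  obtain ⟨p, -, hp⟩ := LowerSemicontinuousOn.exists_isMinOn (s := (univ : Set (X × X)))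
    univ_nonempty isCompact_univ (hκ.lsc.lowerSemicontinuousOn _)
  obtain ⟨r, hr⟩ : ∃ r : ℝ, (r : EReal) ≤ κ p.1 p.2 := by
    induction h : κ p.1 p.2 using EReal.rec with
    | bot => exact absurd h (hκ.bot_lt _ _).ne'
    | coe r => exact ⟨r, le_rfl⟩
    | top => exact ⟨0, le_top⟩
  refine ⟨(-r).toNNReal, fun x y => le_trans ?_ (hr.trans (hp (mem_univ (x, y))))⟩
  rw [EReal.neg_le, ← EReal.coe_neg]
  have : ((((-r).toNNReal : ℝ≥0) : ℝ≥0∞) : EReal) = (((-r).toNNReal : ℝ) : EReal) := rfl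
  rw [this, EReal.coe_le_coe_iff]
  exact Real.le_coe_toNNReal _

/-- On compact `X` a lower semicontinuous function attains its minimum, which is not `-∞`, so adding
a constant makes the kernel nonnegative; otherwise `C = 0` works. -/
theorem IsKernel.exists_isShift {κ : X → X → EReal} (hκ : IsKernel κ) :
    ∃ k C, IsShift κ k C := by
  obtain ⟨C, hC, hle⟩ : ∃ C : ℝ≥0, (C = 0 ∨ CompactSpace X) ∧
      ∀ x y, -((C : ℝ≥0∞) : EReal) ≤ κ x y := by
    by_cases hX : CompactSpace X
    · obtain ⟨C, hC⟩ := hκ.exists_le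
      exact ⟨C, Or.inr hX, hC⟩
    · exact ⟨0, Or.inl rfl, by simpa using hκ.nonneg hX⟩
  have hC1 : ((C : ℝ≥0∞) : EReal) ≠ ⊥ := by simp
  have hC2 : ((C : ℝ≥0∞) : EReal) ≠ ⊤ := by simp
  have h0 : ∀ x y, 0 ≤ κ x y + ((C : ℝ≥0∞) : EReal) := fun x y => by
    have := add_le_add_left (hle x y) ((C : ℝ≥0∞) : EReal)
    rwa [add_comm (-_), ← sub_eq_add_neg, EReal.sub_self hC2 hC1] at this
  refine ⟨fun x y => (κ x y + ((C : ℝ≥0∞) : EReal)).toENNReal, C, fun x y => ?_, fun x y => ?_, ?_,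
    hC⟩
  · rw [EReal.coe_toENNReal (h0 x y)]
    exact (EReal.add_sub_cancel_right (b := (C : ℝ))).symm
  · rw [hκ.symm]
  · refine Continuous.comp_lowerSemicontinuous
      (g := fun z : EReal => (z + ((C : ℝ≥0∞) : EReal)).toENNReal)
      (EReal.continuous_toENNReal.comp (continuous_add_const_of_finite hC1 hC2)) hκ.lsc ?_
    intro a b hab
    exact EReal.toENNReal_le_toENNReal (add_le_add_left hab _)

end Shift

/-! ### Integrals of functions bounded below -/

section Eintegral

variable {X : Type*} [MeasurableSpace X]

theorem eintegral_mono_ae {μ : Measure X} {f g : X → EReal} (h : ∀ᵐ x ∂μ, f x ≤ g x) :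
    eintegral μ f ≤ eintegral μ g := by
  refine EReal.sub_le_sub ?_ ?_ <;> rw [EReal.coe_ennreal_le_coe_ennreal_iff] <;>
    refine lintegral_mono_ae (h.mono fun x hx => EReal.toENNReal_le_toENNReal ?_)
  · exact hx
  · exact EReal.neg_le_neg_iff.2 hx

theorem eintegral_one (μ : Measure X) : eintegral μ (fun _ => 1) = ((μ univ : ℝ≥0∞) : EReal) := by
  have h1 : (1 : EReal).toENNReal = 1 := EReal.toENNReal_coe (x := 1)
  simp [eintegral, h1]

theorem coe_sub_coe_eq_coe_sub_coe {a b c d : ℝ≥0∞} (hb : b ≠ ⊤) (hd : d ≠ ⊤)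
    (h : a + d = b + c) : (a : EReal) - b = (c : EReal) - d := by
  lift b to ℝ≥0 using hb
  lift d to ℝ≥0 using hd
  rcases eq_or_ne c ⊤ with rfl | hc
  · have ha : a = ⊤ := by simpa using h
    subst ha
    change (⊤ : EReal) - (b : ℝ) = ⊤ - (d : ℝ)
    simp
  · have ha : a ≠ ⊤ := fun ha => by
      subst ha
      rw [top_add] at h
      exact ENNReal.add_ne_top.2 ⟨ENNReal.coe_ne_top, hc⟩ h.symm
    lift a to ℝ≥0 using ha
    lift c to ℝ≥0 using hc
    have h' : (a : ℝ) + d = b + c := by exact_mod_cast h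
    change ((a : ℝ) : EReal) - (b : ℝ) = (c : ℝ) - (d : ℝ)
    rw [← EReal.coe_sub, ← EReal.coe_sub, EReal.coe_eq_coe_iff]
    linarith

theorem eintegral_coe_sub {μ : Measure X} {g : X → ℝ≥0∞} (hg : Measurable g) {c : ℝ≥0∞}
    (hc : c ≠ ⊤) (hcμ : c * μ univ ≠ ⊤) :
    eintegral μ (fun x => (g x : EReal) - (c : EReal)) =
      ((∫⁻ x, g x ∂μ : ℝ≥0∞) : EReal) - ((c * μ univ : ℝ≥0∞) : EReal) := by
  have hpos : ∀ x, ((g x : EReal) - (c : EReal)).toENNReal = g x - c := fun x => by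
    rw [EReal.toENNReal_sub (EReal.coe_ennreal_nonneg c), EReal.toENNReal_coe, EReal.toENNReal_coe]
  have hneg : ∀ x, (-((g x : EReal) - (c : EReal))).toENNReal = c - g x := fun x => by
    rw [EReal.neg_sub (.inl (by simp)) (.inr (by simpa using hc)), add_comm, ← sub_eq_add_neg,
      EReal.toENNReal_sub (EReal.coe_ennreal_nonneg _), EReal.toENNReal_coe, EReal.toENNReal_coe]
  have hfin : ∫⁻ x, (c - g x) ∂μ ≠ ⊤ := by
    refine ne_top_of_le_ne_top hcμ ?_
    rw [← lintegral_const]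
    exact lintegral_mono fun x => tsub_le_self
  unfold eintegral
  simp_rw [hpos, hneg]
  -- In additive form the claim follows from the pointwise identity `(g - c) + c = (c - g) + g` for
  -- truncated differences, both sides being `max g c`.
  refine coe_sub_coe_eq_coe_sub_coe hfin hcμ ?_
  rw [← lintegral_const, ← lintegral_add_right _ measurable_const, ← lintegral_add_right _ hg]
  refine lintegral_congr fun x => ?_
  rcases le_total c (g x) with h | h
  · rw [tsub_add_cancel_of_le h, tsub_eq_zero_of_le h, zero_add]
  · rw [tsub_add_cancel_of_le h, tsub_eq_zero_of_le h, zero_add]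

/-- The mutual energy of two measures with respect to a nonnegative kernel. -/
def lenergy (k : X → X → ℝ≥0∞) (μ ν : Measure X) : ℝ≥0∞ :=
  ∫⁻ x, ∫⁻ y, k x y ∂μ ∂ν

theorem lenergy_add_right (k : X → X → ℝ≥0∞) (μ ν₁ ν₂ : Measure X) :
    lenergy k μ (ν₁ + ν₂) = lenergy k μ ν₁ + lenergy k μ ν₂ :=
  lintegral_add_measure _ _ _

theorem lenergy_smul_right (k : X → X → ℝ≥0∞) (μ ν : Measure X) (c : ℝ≥0) :
    lenergy k μ (c • ν) = c * lenergy k μ ν :=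
  lintegral_smul_measure _ _

end Eintegral

/-! ### Potentials and energies in terms of the shifted kernel -/

section Formulas

variable {X : Type*} [TopologicalSpace X] [MeasurableSpace X]

namespace IsShift

variable {κ : X → X → EReal} {k : X → X → ℝ≥0∞} {C : ℝ≥0}

theorem mul_univ_ne_top (h : IsShift κ k C) (μ : Measure X) [IsFiniteMeasureOnCompacts μ] :
    (C : ℝ≥0∞) * μ univ ≠ ⊤ := by
  rcases h.compact with h0 | h0
  · simp [h0]
  · exact ENNReal.mul_ne_top ENNReal.coe_ne_top isCompact_univ.measure_lt_top.ne

theorem mul_univ_mul_univ_ne_top (h : IsShift κ k C) (μ ν : Measure X)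
    [IsFiniteMeasureOnCompacts μ] [IsFiniteMeasureOnCompacts ν] :
    (C : ℝ≥0∞) * μ univ * ν univ ≠ ⊤ := by
  rcases h.compact with h0 | h0
  · simp [h0]
  · exact ENNReal.mul_ne_top (h.mul_univ_ne_top μ) isCompact_univ.measure_lt_top.ne

theorem measurable_section [OpensMeasurableSpace X] (h : IsShift κ k C) (x : X) :
    Measurable (k x) :=
  (h.lsc.comp (Continuous.prodMk_right x)).measurable

theorem potential_eq [OpensMeasurableSpace X] (h : IsShift κ k C) (μ : Measure X)
    [IsFiniteMeasureOnCompacts μ] (x : X) :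
    potential κ μ x = ((∫⁻ y, k x y ∂μ : ℝ≥0∞) : EReal) - ((C * μ univ : ℝ≥0∞) : EReal) := by
  unfold potential
  simp_rw [h.eq]
  exact eintegral_coe_sub (h.measurable_section x) ENNReal.coe_ne_top (h.mul_univ_ne_top μ)

variable [LocallyCompactSpace X] [T2Space X] [BorelSpace X]

theorem measurable_lintegral (h : IsShift κ k C) (μ : Measure X) [μ.Regular] :
    Measurable fun x => ∫⁻ y, k x y ∂μ :=
  (lowerSemicontinuous_lintegral_section μ h.lsc).measurable

theorem lowerSemicontinuous_potential (h : IsShift κ k C) (μ : Measure X) [μ.Regular] :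
    LowerSemicontinuous (potential κ μ) := by
  have : potential κ μ =
      (fun z : ℝ≥0∞ => (z : EReal) - ((C * μ univ : ℝ≥0∞) : EReal)) ∘ fun x => ∫⁻ y, k x y ∂μ :=
    funext fun x => h.potential_eq μ x
  rw [this]
  refine Continuous.comp_lowerSemicontinuous
    (continuous_sub_const_of_finite (h.mul_univ_ne_top μ))
    (lowerSemicontinuous_lintegral_section μ h.lsc) fun a b hab => ?_
  exact EReal.sub_le_sub (EReal.coe_ennreal_le_coe_ennreal_iff.2 hab) le_rfl

theorem energy_eq (h : IsShift κ k C) (μ ν : Measure X) [μ.Regular] [ν.Regular] :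
    energy κ μ ν =
      (lenergy k μ ν : EReal) - ((C * μ univ * ν univ : ℝ≥0∞) : EReal) := by
  unfold energy
  rw [funext fun x => h.potential_eq μ x]
  exact eintegral_coe_sub (h.measurable_lintegral μ) (h.mul_univ_ne_top μ)
    (h.mul_univ_mul_univ_ne_top μ ν)

theorem lenergy_comm (h : IsShift κ k C) (μ ν : Measure X) [μ.Regular] [ν.Regular] :
    lenergy k μ ν = lenergy k ν μ :=
  lintegral_lintegral_swap_of_lsc μ ν h.lsc h.symm

theorem energy_comm (h : IsShift κ k C) (μ ν : Measure X) [μ.Regular] [ν.Regular] :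
    energy κ μ ν = energy κ ν μ := by
  rw [h.energy_eq, h.energy_eq, h.lenergy_comm, mul_right_comm]

theorem lenergy_eq_top_iff (h : IsShift κ k C) (μ ν : Measure X) [μ.Regular] [ν.Regular] :
    lenergy k μ ν = ⊤ ↔ energy κ μ ν = ⊤ := by
  rw [h.energy_eq]
  have hne := h.mul_univ_mul_univ_ne_top μ ν
  lift (C : ℝ≥0∞) * μ univ * ν univ to ℝ≥0 using hne with c
  constructor
  · intro h1
    rw [h1]
    exact EReal.top_sub_coe c
  · intro h1
    by_contra h2
    lift lenergy k μ ν to ℝ≥0 using h2 with d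
    exact EReal.coe_ne_top ((d : ℝ) - c) h1

theorem energy_eq_coe (h : IsShift κ k C) {μ ν : Measure X} [μ.Regular] [ν.Regular]
    (hfin : lenergy k μ ν ≠ ⊤) : energy κ μ ν =
      (((lenergy k μ ν).toReal - (C * μ.real univ * ν.real univ) : ℝ) : EReal) := by
  rw [h.energy_eq]
  have hne := h.mul_univ_mul_univ_ne_top μ ν
  have h1 : (C : ℝ) * μ.real univ * ν.real univ = (C * μ univ * ν univ : ℝ≥0∞).toReal := by
    simp [Measure.real]
  rw [h1]
  lift (C : ℝ≥0∞) * μ univ * ν univ to ℝ≥0 using hne with c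
  lift lenergy k μ ν to ℝ≥0 using hfin with d
  rfl

end IsShift

end Formulas

/-! ### The energy form on measures of finite energy -/

section MutualEnergy

variable {X : Type*} [MeasurableSpace X]

/-- The mutual energy as a real number, for measures of finite energy. -/
def mutualEnergy (κ : X → X → EReal) (μ ν : Measure X) : ℝ :=
  (energy κ μ ν).toReal

theorem strongDist_eq (κ : X → X → EReal) (μ ν : Measure X) :
    strongDist κ μ ν =
      √(mutualEnergy κ μ μ + mutualEnergy κ ν ν - 2 * mutualEnergy κ μ ν) := rfl

theorem EnergyPrinciple.eq_of_sq_nonpos [TopologicalSpace X] {κ : X → X → EReal}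
    (hκ : EnergyPrinciple κ) {μ ν : Measure X} (hμ : μ ∈ EPlus κ) (hν : ν ∈ EPlus κ)
    (h : mutualEnergy κ μ μ + mutualEnergy κ ν ν - 2 * mutualEnergy κ μ ν ≤ 0) : μ = ν := by
  refine hκ μ hμ ν hν ?_
  rw [strongDist_eq, Real.sqrt_eq_zero_of_nonpos h]

variable [TopologicalSpace X] [LocallyCompactSpace X] [T2Space X] [BorelSpace X]
  {κ : X → X → EReal} {k : X → X → ℝ≥0∞} {C : ℝ≥0} {μ ν : Measure X}

theorem IsShift.mem_EPlus_iff (h : IsShift κ k C) :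
    μ ∈ EPlus κ ↔ μ.Regular ∧ lenergy k μ μ ≠ ⊤ := by
  refine and_congr_right fun hμ => ?_
  rw [lt_top_iff_ne_top, Ne, Ne, h.lenergy_eq_top_iff]

/-- Positive definiteness bounds twice the mutual energy by the sum of the two energies. -/
theorem IsShift.lenergy_ne_top (h : IsShift κ k C) (hκ : IsPositiveDefinite κ)
    (hμ : μ ∈ EPlus κ) (hν : ν ∈ EPlus κ) : lenergy k μ ν ≠ ⊤ := by
  have := hμ.1
  have := hν.1
  rw [Ne, h.lenergy_eq_top_iff]
  intro htop
  have h1 := hκ μ ν hμ.1 hν.1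
  rw [htop, EReal.mul_top_of_pos (by norm_num), top_le_iff] at h1
  exact EReal.add_ne_top hμ.2.ne hν.2.ne h1

theorem IsShift.mutualEnergy_eq (h : IsShift κ k C) (hκ : IsPositiveDefinite κ)
    (hμ : μ ∈ EPlus κ) (hν : ν ∈ EPlus κ) : mutualEnergy κ μ ν =
      (lenergy k μ ν).toReal - C * μ.real univ * ν.real univ := by
  have := hμ.1
  have := hν.1
  rw [mutualEnergy, h.energy_eq_coe (h.lenergy_ne_top hκ hμ hν), EReal.toReal_coe]

namespace IsPerfect

variable (hκ : IsPerfect κ)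
include hκ

theorem lowerSemicontinuous_potential (hμ : μ.Regular) :
    LowerSemicontinuous (potential κ μ) := by
  obtain ⟨k, C, h⟩ := hκ.isKernel.exists_isShift
  exact h.lowerSemicontinuous_potential μ

theorem coe_mutualEnergy (hμ : μ ∈ EPlus κ) (hν : ν ∈ EPlus κ) :
    energy κ μ ν = (mutualEnergy κ μ ν : EReal) := by
  obtain ⟨k, C, h⟩ := hκ.isKernel.exists_isShift
  have := hμ.1
  have := hν.1
  rw [mutualEnergy, h.energy_eq_coe (h.lenergy_ne_top hκ.positiveDefinite hμ hν),
    EReal.toReal_coe]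

theorem mutualEnergy_comm (hμ : μ ∈ EPlus κ) (hν : ν ∈ EPlus κ) :
    mutualEnergy κ μ ν = mutualEnergy κ ν μ := by
  obtain ⟨k, C, h⟩ := hκ.isKernel.exists_isShift
  have := hμ.1
  have := hν.1
  rw [mutualEnergy, mutualEnergy, h.energy_comm]

theorem zero_mem_EPlus : (0 : Measure X) ∈ EPlus κ := by
  obtain ⟨k, C, h⟩ := hκ.isKernel.exists_isShift
  rw [h.mem_EPlus_iff]
  exact ⟨inferInstance, by simp [lenergy]⟩

theorem smul_mem_EPlus (hμ : μ ∈ EPlus κ) (c : ℝ≥0) : c • μ ∈ EPlus κ := by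
  obtain ⟨k, C, h⟩ := hκ.isKernel.exists_isShift
  have := hμ.1
  rw [h.mem_EPlus_iff] at hμ ⊢
  refine ⟨inferInstance, ?_⟩
  rw [lenergy_smul_right, h.lenergy_comm, lenergy_smul_right]
  exact ENNReal.mul_ne_top ENNReal.coe_ne_top (ENNReal.mul_ne_top ENNReal.coe_ne_top hμ.2)

theorem add_mem_EPlus (hμ : μ ∈ EPlus κ) (hν : ν ∈ EPlus κ) : μ + ν ∈ EPlus κ := by
  obtain ⟨k, C, h⟩ := hκ.isKernel.exists_isShift
  have h1 := h.lenergy_ne_top hκ.positiveDefinite hμ hν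
  have h2 := h.lenergy_ne_top hκ.positiveDefinite hν hμ
  rw [h.mem_EPlus_iff] at hμ hν ⊢
  have := hμ.1
  have := hν.1
  have hreg : (μ + ν).Regular := regular_add hμ.1 hν.1
  refine ⟨hreg, ?_⟩
  rw [lenergy_add_right, h.lenergy_comm, h.lenergy_comm _ ν, lenergy_add_right,
    lenergy_add_right]
  simp [h1, h2, hμ.2, hν.2]

theorem restrict_mem_EPlus (hμ : μ ∈ EPlus κ) {K : Set X} (hK : μ K ≠ ⊤) :
    μ.restrict K ∈ EPlus κ := by
  obtain ⟨k, C, h⟩ := hκ.isKernel.exists_isShift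
  rw [h.mem_EPlus_iff] at hμ ⊢
  have := hμ.1
  refine ⟨Measure.Regular.restrict_of_measure_ne_top hK, ?_⟩
  refine ne_top_of_le_ne_top hμ.2 ?_
  exact lintegral_mono' Measure.restrict_le_self
    fun x => lintegral_mono' Measure.restrict_le_self le_rfl

theorem mutualEnergy_smul_right (hμ : μ ∈ EPlus κ) (hν : ν ∈ EPlus κ) (c : ℝ≥0) :
    mutualEnergy κ μ (c • ν) = c * mutualEnergy κ μ ν := by
  obtain ⟨k, C, h⟩ := hκ.isKernel.exists_isShift
  rw [h.mutualEnergy_eq hκ.positiveDefinite hμ hν,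
    h.mutualEnergy_eq hκ.positiveDefinite hμ (hκ.smul_mem_EPlus hν c), lenergy_smul_right,
    measureReal_nnreal_smul_apply, ENNReal.toReal_mul, ENNReal.coe_toReal]
  ring

theorem mutualEnergy_smul_left (hμ : μ ∈ EPlus κ) (hν : ν ∈ EPlus κ) (c : ℝ≥0) :
    mutualEnergy κ (c • μ) ν = c * mutualEnergy κ μ ν := by
  rw [hκ.mutualEnergy_comm (hκ.smul_mem_EPlus hμ c) hν, hκ.mutualEnergy_smul_right hν hμ,
    hκ.mutualEnergy_comm hν hμ]

theorem mutualEnergy_add_right {μ ν₁ ν₂ : Measure X} (hμ : μ ∈ EPlus κ) (hν₁ : ν₁ ∈ EPlus κ)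
    (hν₂ : ν₂ ∈ EPlus κ) :
    mutualEnergy κ μ (ν₁ + ν₂) = mutualEnergy κ μ ν₁ + mutualEnergy κ μ ν₂ := by
  obtain ⟨k, C, h⟩ := hκ.isKernel.exists_isShift
  have := hν₁.1
  have := hν₂.1
  have hC : (C : ℝ) * (ν₁ + ν₂).real univ = C * ν₁.real univ + C * ν₂.real univ := by
    rcases h.compact with h0 | h0
    · simp [h0]
    · rw [measureReal_add_apply isCompact_univ.measure_lt_top.ne
        isCompact_univ.measure_lt_top.ne, mul_add]
  rw [h.mutualEnergy_eq hκ.positiveDefinite hμ hν₁, h.mutualEnergy_eq hκ.positiveDefinite hμ hν₂,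
    h.mutualEnergy_eq hκ.positiveDefinite hμ (hκ.add_mem_EPlus hν₁ hν₂), lenergy_add_right,
    ENNReal.toReal_add (h.lenergy_ne_top hκ.positiveDefinite hμ hν₁)
      (h.lenergy_ne_top hκ.positiveDefinite hμ hν₂)]
  linear_combination (-μ.real univ) * hC

theorem mutualEnergy_add_left {μ₁ μ₂ ν : Measure X} (hμ₁ : μ₁ ∈ EPlus κ) (hμ₂ : μ₂ ∈ EPlus κ)
    (hν : ν ∈ EPlus κ) :
    mutualEnergy κ (μ₁ + μ₂) ν = mutualEnergy κ μ₁ ν + mutualEnergy κ μ₂ ν := by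
  rw [hκ.mutualEnergy_comm (hκ.add_mem_EPlus hμ₁ hμ₂) hν, hκ.mutualEnergy_add_right hν hμ₁ hμ₂,
    hκ.mutualEnergy_comm hν hμ₁, hκ.mutualEnergy_comm hν hμ₂]

theorem two_mul_mutualEnergy_le (hμ : μ ∈ EPlus κ) (hν : ν ∈ EPlus κ) :
    2 * mutualEnergy κ μ ν ≤ mutualEnergy κ μ μ + mutualEnergy κ ν ν := by
  have := hκ.positiveDefinite μ ν hμ.1 hν.1
  rw [hκ.coe_mutualEnergy hμ hν, hκ.coe_mutualEnergy hμ hμ, hκ.coe_mutualEnergy hν hν] at this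
  rw [show (2 : EReal) = ((2 : ℝ) : EReal) from rfl] at this
  exact_mod_cast this

theorem mutualEnergy_zero_left (hμ : μ ∈ EPlus κ) : mutualEnergy κ 0 μ = 0 := by
  simpa using hκ.mutualEnergy_smul_left hκ.zero_mem_EPlus hμ 0

theorem mutualEnergy_self_nonneg (hμ : μ ∈ EPlus κ) : 0 ≤ mutualEnergy κ μ μ := by
  have := hκ.two_mul_mutualEnergy_le hκ.zero_mem_EPlus hμ
  rw [hκ.mutualEnergy_zero_left hμ, hκ.mutualEnergy_zero_left hκ.zero_mem_EPlus] at this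
  linarith

theorem strongDist_sq (hμ : μ ∈ EPlus κ) (hν : ν ∈ EPlus κ) :
    strongDist κ μ ν ^ 2 =
      mutualEnergy κ μ μ + mutualEnergy κ ν ν - 2 * mutualEnergy κ μ ν := by
  rw [strongDist_eq, Real.sq_sqrt]
  linarith [hκ.two_mul_mutualEnergy_le hμ hν]

theorem strongDist_comm (hμ : μ ∈ EPlus κ) (hν : ν ∈ EPlus κ) :
    strongDist κ μ ν = strongDist κ ν μ := by
  rw [strongDist_eq, strongDist_eq, hκ.mutualEnergy_comm hμ hν, add_comm (mutualEnergy κ μ μ)]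

/-- The parallelogram law with `‖μ + ν - 2ρ‖² ≥ 0` discarded. It plays the role of the triangle
inequality. -/
theorem strongDist_sq_le {μ ν ρ : Measure X} (hμ : μ ∈ EPlus κ) (hν : ν ∈ EPlus κ)
    (hρ : ρ ∈ EPlus κ) :
    strongDist κ μ ν ^ 2 ≤ 2 * strongDist κ μ ρ ^ 2 + 2 * strongDist κ ν ρ ^ 2 := by
  have h2 := hκ.smul_mem_EPlus hρ 2
  have := hκ.two_mul_mutualEnergy_le (hκ.add_mem_EPlus hμ hν) h2
  rw [hκ.mutualEnergy_add_left hμ hν h2, hκ.mutualEnergy_add_left hμ hν (hκ.add_mem_EPlus hμ hν),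
    hκ.mutualEnergy_add_right hμ hμ hν, hκ.mutualEnergy_add_right hν hμ hν,
    hκ.mutualEnergy_smul_right hμ hρ, hκ.mutualEnergy_smul_right hν hρ,
    hκ.mutualEnergy_smul_left hρ h2, hκ.mutualEnergy_smul_right hρ hρ,
    hκ.mutualEnergy_comm hν hμ] at this
  rw [hκ.strongDist_sq hμ hν, hκ.strongDist_sq hμ hρ, hκ.strongDist_sq hν hρ]
  push_cast at this
  linarith

/-- The right side minus the left is `t⁻¹ ‖μ - (1 + t) ν‖²`. Letting `t → 0` after a strong limit
yields continuity of the energy. -/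
theorem mutualEnergy_self_le (hμ : μ ∈ EPlus κ) (hν : ν ∈ EPlus κ) {t : ℝ} (ht : 0 < t) :
    mutualEnergy κ μ μ ≤ (1 + t) * mutualEnergy κ ν ν + (1 + t⁻¹) * strongDist κ μ ν ^ 2 := by
  lift t to ℝ≥0 using ht.le
  have h2 := hκ.smul_mem_EPlus hν (1 + t)
  have := hκ.two_mul_mutualEnergy_le hμ h2
  rw [hκ.mutualEnergy_smul_right hμ hν, hκ.mutualEnergy_smul_left hν h2,
    hκ.mutualEnergy_smul_right hν hν] at this
  rw [hκ.strongDist_sq hμ hν]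
  push_cast at this
  have h3 : 0 ≤ (t : ℝ)⁻¹ * (mutualEnergy κ μ μ + (1 + t) * ((1 + t) * mutualEnergy κ ν ν) -
      2 * ((1 + t) * mutualEnergy κ μ ν)) := mul_nonneg (by positivity) (by linarith)
  have h4 : (t : ℝ)⁻¹ * t = 1 := inv_mul_cancel₀ ht.ne'
  linear_combination h3 + (mutualEnergy κ ν ν * (2 + t) - 2 * mutualEnergy κ μ ν) * h4

end IsPerfect

end MutualEnergy

/-! ### Measures concentrated on a set -/

section Concentrated

variable {X : Type*} [TopologicalSpace X] [MeasurableSpace X] {μ ν : Measure X} {A B : Set X}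

theorem ConcentratedOn.mono (h : ConcentratedOn μ A) (hAB : A ⊆ B) : ConcentratedOn μ B :=
  fun K hK => measure_mono_null (inter_subset_inter_left _ (compl_subset_compl.2 hAB)) (h K hK)

theorem ConcentratedOn.smul (h : ConcentratedOn μ A) (c : ℝ≥0) : ConcentratedOn (c • μ) A :=
  fun K hK => by simp [h K hK]

theorem ConcentratedOn.add (h : ConcentratedOn μ A) (h' : ConcentratedOn ν A) :
    ConcentratedOn (μ + ν) A :=
  fun K hK => by simp [h K hK, h' K hK]

theorem concentratedOn_zero (A : Set X) : ConcentratedOn (0 : Measure X) A :=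
  fun K _ => by simp

theorem concentratedOn_restrict {K : Set X} (hK : MeasurableSet K) (h : μ (Aᶜ ∩ K) = 0) :
    ConcentratedOn (μ.restrict K) A := fun L _ => by
  rw [Measure.restrict_apply' hK]
  exact measure_mono_null (inter_subset_inter_left _ inter_subset_left) h

theorem ConcentratedOn.restrict (h : ConcentratedOn μ A) (K : Set X) :
    ConcentratedOn (μ.restrict K) A :=
  fun L hL => Measure.absolutelyContinuous_of_le Measure.restrict_le_self (h L hL)

theorem ConcentratedOn.measure_compl_eq_zero [OpensMeasurableSpace X] [T2Space X]
    (h : ConcentratedOn μ A) (hμ : μ.Regular) (hfin : μ univ ≠ ⊤) : μ Aᶜ = 0 := by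
  refine le_antisymm (le_of_forall_pos_le_add fun ε hε => ?_) zero_le
  obtain ⟨K, -, hK, hKε⟩ := MeasurableSet.univ.exists_isCompact_lt_add hfin hε.ne'
  have hKc : μ Kᶜ ≤ ε := by
    rw [measure_compl hK.measurableSet hK.measure_lt_top.ne]
    exact tsub_le_iff_left.2 hKε.le
  calc μ Aᶜ ≤ μ (Aᶜ ∩ K) + μ (Aᶜ \ K) := measure_le_inter_add_sdiff _ _ _
    _ ≤ 0 + ε := add_le_add (h K hK).le ((measure_mono fun x hx => hx.2).trans hKc)

theorem concentratedOn_of_measure_compl_eq_zero (h : μ Aᶜ = 0) : ConcentratedOn μ A :=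
  fun _ _ => measure_mono_null inter_subset_left h

end Concentrated

/-! ### Mass, energy and capacity -/

section Bounds

theorem one_le_coe_sub_iff {u c : ℝ≥0∞} (hc : c ≠ ⊤) :
    (1 : EReal) ≤ (u : EReal) - c ↔ 1 + c ≤ u := by
  rw [EReal.le_sub_iff_add_le (.inl (by simp)) (.inl (by simpa using hc)),
    ← EReal.coe_ennreal_le_coe_ennreal_iff]
  simp

theorem coe_sub_le_one_iff {u c : ℝ≥0∞} (hc : c ≠ ⊤) :
    (u : EReal) - c ≤ (1 : EReal) ↔ u ≤ 1 + c := by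
  rw [EReal.sub_le_iff_le_add (.inl (by simp)) (.inl (by simpa using hc)),
    ← EReal.coe_ennreal_le_coe_ennreal_iff]
  simp

variable {X : Type*} [TopologicalSpace X] [MeasurableSpace X] [LocallyCompactSpace X] [T2Space X]
  [BorelSpace X] {κ : X → X → EReal} {μ ν : Measure X} {A D : Set X}

namespace IsPerfect

variable (hκ : IsPerfect κ)
include hκ

theorem real_univ_le_mutualEnergy (hμ : μ ∈ EPlus κ) (hν : ν ∈ EPlus κ) (hfin : ν univ ≠ ⊤)
    (h : ∀ᵐ x ∂ν, 1 ≤ potential κ μ x) : ν.real univ ≤ mutualEnergy κ μ ν := by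
  have := eintegral_mono_ae h
  rw [eintegral_one] at this
  change _ ≤ energy κ μ ν at this
  rw [hκ.coe_mutualEnergy hμ hν, ← ENNReal.ofReal_toReal hfin, EReal.coe_ennreal_ofReal,
    max_eq_left ENNReal.toReal_nonneg] at this
  exact_mod_cast this

theorem mutualEnergy_le_real_univ (hμ : μ ∈ EPlus κ) (hν : ν ∈ EPlus κ) (hfin : ν univ ≠ ⊤)
    (h : ∀ᵐ x ∂ν, potential κ μ x ≤ 1) : mutualEnergy κ μ ν ≤ ν.real univ := by
  have := eintegral_mono_ae h
  rw [eintegral_one] at this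
  change energy κ μ ν ≤ _ at this
  rw [hκ.coe_mutualEnergy hμ hν, ← ENNReal.ofReal_toReal hfin, EReal.coe_ennreal_ofReal,
    max_eq_left ENNReal.toReal_nonneg] at this
  exact_mod_cast this

/-- Comparing `κμ` with `1` becomes comparing the nonnegative function `U` with `1 + c`, where
equality of integrals implies equality a.e. -/
theorem exists_lintegral_potential (hμ : μ ∈ EPlus κ) (hν : ν ∈ EPlus κ) :
    ∃ (U : X → ℝ≥0∞) (c : ℝ≥0∞), Measurable U ∧ c ≠ ⊤ ∧
      (∀ x, potential κ μ x = (U x : EReal) - c) ∧ ∫⁻ x, U x ∂ν ≠ ⊤ ∧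
      (∫⁻ x, U x ∂ν).toReal - (∫⁻ _, (1 + c) ∂ν).toReal = mutualEnergy κ μ ν - ν.real univ := by
  obtain ⟨k, C, h⟩ := hκ.isKernel.exists_isShift
  have := hμ.1
  have hc := h.mul_univ_ne_top μ
  refine ⟨fun x => ∫⁻ y, k x y ∂μ, C * μ univ, h.measurable_lintegral μ, hc,
    h.potential_eq μ, h.lenergy_ne_top hκ.positiveDefinite hμ hν, ?_⟩
  rw [h.mutualEnergy_eq hκ.positiveDefinite hμ hν, lintegral_const, ENNReal.toReal_mul,
    ENNReal.toReal_add ENNReal.one_ne_top hc, ENNReal.toReal_mul]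
  simp only [lenergy, Measure.real, ENNReal.toReal_one, ENNReal.coe_toReal]
  ring

theorem ae_eq_one_of_one_le (hμ : μ ∈ EPlus κ) (hν : ν ∈ EPlus κ) (hfin : ν univ ≠ ⊤)
    (h : ∀ᵐ x ∂ν, 1 ≤ potential κ μ x) (hle : mutualEnergy κ μ ν ≤ ν.real univ) :
    ∀ᵐ x ∂ν, potential κ μ x = 1 := by
  obtain ⟨U, c, hU, hc, hpot, hUfin, heq⟩ := hκ.exists_lintegral_potential hμ hν
  have hcfin : ∫⁻ _, (1 + c) ∂ν ≠ ⊤ := by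
    rw [lintegral_const]
    exact ENNReal.mul_ne_top (ENNReal.add_ne_top.2 ⟨ENNReal.one_ne_top, hc⟩) hfin
  have key : (fun _ => 1 + c) =ᵐ[ν] U := by
    refine ae_eq_of_ae_le_of_lintegral_le ?_ hcfin hU.aemeasurable ?_
    · filter_upwards [h] with x hx
      rwa [hpot, one_le_coe_sub_iff hc] at hx
    · rw [← ENNReal.toReal_le_toReal hUfin hcfin]
      linarith
  filter_upwards [key] with x hx
  rw [hpot]
  exact le_antisymm ((coe_sub_le_one_iff hc).2 hx.ge) ((one_le_coe_sub_iff hc).2 hx.le)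

theorem ae_eq_one_of_le_one (hμ : μ ∈ EPlus κ) (hν : ν ∈ EPlus κ) (hfin : ν univ ≠ ⊤)
    (h : ∀ᵐ x ∂ν, potential κ μ x ≤ 1) (hle : ν.real univ ≤ mutualEnergy κ μ ν) :
    ∀ᵐ x ∂ν, potential κ μ x = 1 := by
  obtain ⟨U, c, hU, hc, hpot, hUfin, heq⟩ := hκ.exists_lintegral_potential hμ hν
  have hcfin : ∫⁻ _, (1 + c) ∂ν ≠ ⊤ := by
    rw [lintegral_const]
    exact ENNReal.mul_ne_top (ENNReal.add_ne_top.2 ⟨ENNReal.one_ne_top, hc⟩) hfin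
  have key : U =ᵐ[ν] fun _ => 1 + c := by
    refine ae_eq_of_ae_le_of_lintegral_le ?_ hUfin aemeasurable_const ?_
    · filter_upwards [h] with x hx
      rwa [hpot, coe_sub_le_one_iff hc] at hx
    · rw [← ENNReal.toReal_le_toReal hcfin hUfin]
      linarith
  filter_upwards [key] with x hx
  rw [hpot]
  exact le_antisymm ((coe_sub_le_one_iff hc).2 hx.le) ((one_le_coe_sub_iff hc).2 hx.ge)

theorem smul_mem_EPlusOn (hμ : μ ∈ EPlusOn κ A) (c : ℝ≥0) : c • μ ∈ EPlusOn κ A :=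
  ⟨hκ.smul_mem_EPlus hμ.1 c, hμ.2.smul c⟩

theorem add_mem_EPlusOn (hμ : μ ∈ EPlusOn κ A) (hν : ν ∈ EPlusOn κ A) : μ + ν ∈ EPlusOn κ A :=
  ⟨hκ.add_mem_EPlus hμ.1 hν.1, hμ.2.add hν.2⟩

theorem minEnergy_le (hν : ν ∈ EPlusOn κ D) (h1 : ν univ = 1) :
    minEnergy κ D ≤ ENNReal.ofReal (mutualEnergy κ ν ν) := by
  refine (iInf₂_le (f := fun ν (_ : ν ∈ EPlusOn κ D ∧ ν univ = 1) =>
    (energy κ ν ν).toENNReal) ν ⟨hν, h1⟩).trans ?_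
  rw [hκ.coe_mutualEnergy hν.1 hν.1, EReal.real_coe_toENNReal]

theorem minEnergy_mul_sq_le (hν : ν ∈ EPlusOn κ D) (hfin : ν univ ≠ ⊤) :
    minEnergy κ D * ν univ ^ 2 ≤ ENNReal.ofReal (mutualEnergy κ ν ν) := by
  rcases eq_or_ne (ν univ) 0 with h0 | h0
  · simp [h0]
  have hm : ν univ = ((ν univ).toNNReal : ℝ≥0∞) := (ENNReal.coe_toNNReal hfin).symm
  set m := (ν univ).toNNReal
  have hm0 : m ≠ 0 := fun h => h0 (by rw [hm, h]; rfl)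
  have h1 : (m⁻¹ • ν) univ = 1 := by
    rw [Measure.smul_apply, hm, ENNReal.smul_def, smul_eq_mul, ← ENNReal.coe_mul,
      inv_mul_cancel₀ hm0, ENNReal.coe_one]
  have key := hκ.minEnergy_le (hκ.smul_mem_EPlusOn hν m⁻¹) h1
  rw [hκ.mutualEnergy_smul_left hν.1 (hκ.smul_mem_EPlus hν.1 _),
    hκ.mutualEnergy_smul_right hν.1 hν.1] at key
  rw [hm]
  calc minEnergy κ D * (m : ℝ≥0∞) ^ 2
      ≤ ENNReal.ofReal (((m⁻¹ : ℝ≥0) : ℝ) * (((m⁻¹ : ℝ≥0) : ℝ) * mutualEnergy κ ν ν)) *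
        ENNReal.ofReal ((m : ℝ) ^ 2) := by
        rw [ENNReal.ofReal_pow m.coe_nonneg, ENNReal.ofReal_coe_nnreal]
        gcongr
    _ = ENNReal.ofReal (mutualEnergy κ ν ν) := by
        rw [← ENNReal.ofReal_mul' (by positivity)]
        congr 1
        have : (m : ℝ) ≠ 0 := by exact_mod_cast hm0
        push_cast
        field_simp

/-- Where `κ` takes negative values, restricting a measure may increase its energy. For the
nonnegative shifted kernel it cannot, and undoing the shift costs the term `C ν(X)²`. -/
theorem exists_minEnergy_mul_sq_le :
    ∃ C : ℝ≥0, (C = 0 ∨ CompactSpace X) ∧ ∀ (D K : Set X) (ν : Measure X), ν ∈ EPlus κ →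
      IsCompact K → ν (Dᶜ ∩ K) = 0 → minEnergy κ D * ν K ^ 2 ≤
        ENNReal.ofReal (mutualEnergy κ ν ν) + C * ν univ ^ 2 := by
  obtain ⟨k, C, h⟩ := hκ.isKernel.exists_isShift
  refine ⟨C, h.compact, fun D K ν hν hK h0 => ?_⟩
  have := hν.1
  have hν' := hκ.restrict_mem_EPlus hν hK.measure_lt_top.ne
  have hmem : ν.restrict K ∈ EPlusOn κ D := ⟨hν', concentratedOn_restrict hK.measurableSet h0⟩
  have huniv : ν.restrict K univ = ν K := by simp
  have key := hκ.minEnergy_mul_sq_le hmem (by rw [huniv]; exact hK.measure_lt_top.ne)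
  rw [huniv] at key
  have hfin := h.lenergy_ne_top hκ.positiveDefinite hν hν
  calc minEnergy κ D * ν K ^ 2 ≤ _ := key
    _ ≤ ENNReal.ofReal (lenergy k (ν.restrict K) (ν.restrict K)).toReal := by
        refine ENNReal.ofReal_le_ofReal ?_
        rw [h.mutualEnergy_eq hκ.positiveDefinite hν' hν', sub_le_self_iff]
        positivity
    _ ≤ lenergy k ν ν := by
        refine ENNReal.ofReal_toReal_le.trans ?_
        exact lintegral_mono' Measure.restrict_le_self
          fun x => lintegral_mono' Measure.restrict_le_self le_rfl
    _ = ENNReal.ofReal (mutualEnergy κ ν ν + C * ν.real univ * ν.real univ) := by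
        rw [h.mutualEnergy_eq hκ.positiveDefinite hν hν, sub_add_cancel, ENNReal.ofReal_toReal hfin]
    _ = ENNReal.ofReal (mutualEnergy κ ν ν) + C * ν univ ^ 2 := by
        rw [ENNReal.ofReal_add (hκ.mutualEnergy_self_nonneg hν) (by positivity)]
        congr 1
        have h2 : (C : ℝ) * ν.real univ * ν.real univ = (C * ν univ * ν univ : ℝ≥0∞).toReal := by
          simp [Measure.real]
        rw [h2, ENNReal.ofReal_toReal (h.mul_univ_mul_univ_ne_top ν ν), mul_assoc, sq]

/-- On noncompact `X` the correction term vanishes, so `ν(K)²` is bounded uniformly over compact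
`K`. -/
theorem measure_univ_ne_top (hcap : innerCap κ A < ⊤) (hν : ν ∈ EPlusOn κ A) : ν univ ≠ ⊤ := by
  obtain ⟨C, hC, hbound⟩ := hκ.exists_minEnergy_mul_sq_le
  have := hν.1.1
  rcases hC with hC | hC
  swap
  · exact isCompact_univ.measure_lt_top.ne
  have hw : minEnergy κ A ≠ 0 := (ENNReal.inv_lt_top.1 hcap).ne'
  have hK : ∀ K : Set X, IsCompact K →
      ν K ^ 2 ≤ ENNReal.ofReal (mutualEnergy κ ν ν) / minEnergy κ A := fun K hK => by
    rcases eq_or_ne (ν K) 0 with h0 | h0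
    · simp [h0]
    have h1 := hbound A K ν hν.1 hK (hν.2 K hK)
    rw [hC, ENNReal.coe_zero, zero_mul, add_zero] at h1
    rw [ENNReal.le_div_iff_mul_le (.inl hw) (.inr ENNReal.ofReal_ne_top), mul_comm]
    exact h1
  intro htop
  have hfin : ENNReal.ofReal (mutualEnergy κ ν ν) / minEnergy κ A + 1 ≠ ⊤ :=
    ENNReal.add_ne_top.2 ⟨ENNReal.div_ne_top ENNReal.ofReal_ne_top hw, ENNReal.one_ne_top⟩
  obtain ⟨K, -, hKc, hlt⟩ := isOpen_univ.exists_lt_isCompact (htop ▸ hfin.lt_top)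
  have h1 : (1 : ℝ≥0∞) ≤ ν K := le_add_self.trans hlt.le
  have h2 : ν K ≤ ν K ^ 2 := by
    rw [sq]
    exact le_mul_of_one_le_left' h1
  exact ((le_self_add.trans_lt hlt).trans_le (h2.trans (hK K hKc))).false

/-- If `ν` charged the measurable set where `p` fails, it would charge a compact part of it; the
restriction there would be a nonzero measure of finite energy on a set of capacity zero. -/
theorem ae_of_nearlyEverywhereOn (hν : ν ∈ EPlusOn κ A) (hfin : ν univ ≠ ⊤) {p : X → Prop}
    (hp : MeasurableSet {x | ¬ p x}) (h : NearlyEverywhereOn κ A p) : ∀ᵐ x ∂ν, p x := by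
  rw [ae_iff]
  by_contra h0
  have := hν.1.1
  have hBfin : ν {x | ¬ p x} ≠ ⊤ := measure_ne_top_of_subset (subset_univ _) hfin
  obtain ⟨K, hKB, hK, hKpos⟩ := hp.exists_lt_isCompact_of_ne_top hBfin (pos_iff_ne_zero.2 h0)
  have hw : minEnergy κ {x | x ∈ A ∧ ¬ p x} = ⊤ := ENNReal.inv_eq_zero.1 h
  have hnull : ν ({x | x ∈ A ∧ ¬ p x}ᶜ ∩ K) = 0 := by
    refine measure_mono_null ?_ (hν.2 K hK)
    rintro x ⟨hx, hxK⟩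
    exact ⟨fun hxA => hx ⟨hxA, hKB hxK⟩, hxK⟩
  have key := hκ.minEnergy_mul_sq_le
    ⟨hκ.restrict_mem_EPlus hν.1 hK.measure_lt_top.ne, concentratedOn_restrict hK.measurableSet hnull⟩
    (by simpa using hK.measure_lt_top.ne)
  rw [hw, ENNReal.top_mul (by simpa using hKpos.ne'), top_le_iff] at key
  exact ENNReal.ofReal_ne_top key

end IsPerfect

end Bounds

/-! ### Vague compactness and consistency -/

section Vague

variable {X : Type*} [TopologicalSpace X] [MeasurableSpace X]

theorem clusterPt_vagueTopology {u : Ultrafilter (Measure X)} {μ : Measure X}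
    (h : ∀ f : C_c(X, ℝ), Tendsto (fun ν : Measure X => ∫ x, f x ∂ν) u (𝓝 (∫ x, f x ∂μ))) :
    @ClusterPt _ (vagueTopology X) μ u := by
  let := vagueTopology X
  rw [Ultrafilter.clusterPt_iff, nhds_induced, ← tendsto_iff_comap]
  exact tendsto_pi_nhds.2 h

theorem exists_integral_mem_Icc (f : C_c(X, ℝ)) (M : ℝ≥0) :
    ∃ B : ℝ, ∀ ν : Measure X, ν univ ≤ M → ∫ x, f x ∂ν ∈ Icc (-B) B := by
  obtain ⟨b, hb⟩ := f.continuous.bounded_above_of_compact_support f.hasCompactSupport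
  refine ⟨max b 0 * M, fun ν hν => ?_⟩
  have : IsFiniteMeasure ν := ⟨hν.trans_lt ENNReal.coe_lt_top⟩
  rw [mem_Icc, ← abs_le, ← Real.norm_eq_abs]
  refine (norm_integral_le_of_norm_le_const (Eventually.of_forall hb)).trans ?_
  have hM : ν.real univ ≤ M := ENNReal.toReal_le_coe_of_le_coe hν
  exact mul_le_mul (le_max_left _ _) hM measureReal_nonneg (le_max_right _ _)

variable [LocallyCompactSpace X] [T2Space X] [BorelSpace X]

/-- Vague compactness: an ultrafilter of Radon measures of bounded mass converges vaguely. -/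
theorem exists_tendsto_integral_of_ultrafilter (u : Ultrafilter (Measure X)) (M : ℝ≥0)
    (hreg : ∀ᶠ ν : Measure X in u, ν.Regular) (hM : ∀ᶠ ν : Measure X in u, ν univ ≤ M) :
    ∃ μ : Measure X, μ.Regular ∧
      ∀ f : C_c(X, ℝ), Tendsto (fun ν : Measure X => ∫ x, f x ∂ν) u (𝓝 (∫ x, f x ∂μ)) := by
  have hlim : ∀ f : C_c(X, ℝ), ∃ y, Tendsto (fun ν : Measure X => ∫ x, f x ∂ν) u (𝓝 y) := by
    intro f
    obtain ⟨B, hB⟩ := exists_integral_mem_Icc f M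
    obtain ⟨y, -, hy⟩ := (isCompact_Icc (a := -B) (b := B)).ultrafilter_le_nhds'
      (u.map fun ν : Measure X => ∫ x, f x ∂ν) (hM.mono fun ν hν => hB ν hν)
    exact ⟨y, hy⟩
  choose Λ hΛ using hlim
  have hint : ∀ᶠ ν : Measure X in u, ∀ f : C_c(X, ℝ), Integrable (fun x => f x) ν :=
    hreg.mono fun ν hν f => f.continuous.integrable_of_hasCompactSupport f.hasCompactSupport
  let L : C_c(X, ℝ) →ₗ[ℝ] ℝ :=
    { toFun := Λ
      map_add' := fun f g => by
        refine tendsto_nhds_unique (hΛ (f + g)) (((hΛ f).add (hΛ g)).congr' ?_)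
        filter_upwards [hint] with ν hν
        exact (integral_add (hν f) (hν g)).symm
      map_smul' := fun c f => by
        refine tendsto_nhds_unique (hΛ (c • f)) (((hΛ f).const_mul c).congr fun ν => ?_)
        exact (integral_const_mul c _).symm }
  let P : C_c(X, ℝ) →ₚ[ℝ] ℝ := PositiveLinearMap.mk₀ L fun f hf =>
    ge_of_tendsto' (hΛ f) fun ν => integral_nonneg hf
  refine ⟨RealRMK.rieszMeasure P, inferInstance, fun f => ?_⟩
  rw [RealRMK.integral_rieszMeasure P f]
  exact hΛ f

/-- The mass of an open set is vaguely lower semicontinuous. -/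
theorem measure_isOpen_le_of_tendsto_integral {ι : Type*} {l : Filter ι} [l.NeBot]
    {ν : ι → Measure X} {μ : Measure X} [μ.Regular] (hreg : ∀ i, (ν i).Regular)
    (h : ∀ f : C_c(X, ℝ), Tendsto (fun i => ∫ x, f x ∂(ν i)) l (𝓝 (∫ x, f x ∂μ)))
    {U : Set X} (hU : IsOpen U) {a : ℝ≥0∞} (ha : ∀ i, ν i U ≤ a) : μ U ≤ a := by
  rw [hU.measure_eq_iSup_isCompact]
  refine iSup_le fun K => iSup_le fun hKU => iSup_le fun hK => ?_
  obtain ⟨g, hgK, hgc, hgU, hg01⟩ := exists_continuousMap_one_of_isCompact_subset_isOpen hK hU hKU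
  have hg0 : ∀ x, 0 ≤ g x := fun x => (hg01 x).1
  have h1 : μ K ≤ ENNReal.ofReal (∫ x, g x ∂μ) := by
    rw [← lintegral_ofReal_eq_of_hasCompactSupport μ g.continuous hgc hg0, ← lintegral_indicator_one
      hK.measurableSet]
    refine lintegral_mono fun x => ?_
    by_cases hx : x ∈ K
    · simp [hgK hx, hx]
    · simp [hx]
  refine h1.trans (le_of_tendsto ((ENNReal.continuous_ofReal.tendsto _).comp (h ⟨g, hgc⟩))
    (Eventually.of_forall fun i => le_trans ?_ (ha i)))
  have := hreg i
  change ENNReal.ofReal (∫ x, g x ∂(ν i)) ≤ ν i U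
  rw [← lintegral_ofReal_eq_of_hasCompactSupport (ν i) g.continuous hgc hg0, ← lintegral_indicator_one
      hU.measurableSet]
  refine lintegral_mono fun x => ?_
  by_cases hx : x ∈ U
  · simpa [hx] using (hg01 x).2
  · simp [hx, image_eq_zero_of_notMem_tsupport fun hxg => hx (hgU hxg)]

/-- A strong Cauchy sequence of bounded mass has a strong limit, which is also a vague limit along
an ultrafilter. -/
theorem IsPerfect.exists_strong_limit {κ : X → X → EReal} (hκ : IsPerfect κ) {ν : ℕ → Measure X}
    (hν : ∀ n, ν n ∈ EPlus κ) {M : ℝ≥0} (hM : ∀ n, ν n univ ≤ M)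
    (hcauchy : ∀ ε : ℝ, 0 < ε → ∃ N, ∀ m ≥ N, ∀ n ≥ N, strongDist κ (ν m) (ν n) < ε) :
    ∃ μ ∈ EPlus κ, Tendsto (fun n => strongDist κ (ν n) μ) (hyperfilter ℕ : Filter ℕ) (𝓝 0) ∧
      ∀ f : C_c(X, ℝ), Tendsto (fun n => ∫ x, f x ∂(ν n)) (hyperfilter ℕ : Filter ℕ)
        (𝓝 (∫ x, f x ∂μ)) := by
  -- The vague topology need not be metrizable, so an ultrafilter replaces a convergent subsequence.
  set u : Ultrafilter (Measure X) := (hyperfilter ℕ).map ν with hu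
  have hev : ∀ p : Measure X → Prop, (∀ n, p (ν n)) → ∀ᶠ ρ in u, p ρ := fun p hp =>
    Filter.eventually_map.2 (Eventually.of_forall hp)
  have hreg : ∀ᶠ ρ : Measure X in u, ρ.Regular := hev _ fun n => (hν n).1
  obtain ⟨μ, hμ, htend⟩ := exists_tendsto_integral_of_ultrafilter u M hreg (hev _ hM)
  obtain ⟨hμE, hlim⟩ := hκ.consistent u inferInstance (hev _ hν) (fun ε hε => by
    obtain ⟨N, hN⟩ := hcauchy ε hε
    refine ⟨ν '' Ici N, ?_, ?_⟩
    · change ν ⁻¹' (ν '' Ici N) ∈ (hyperfilter ℕ : Filter ℕ)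
      exact mem_of_superset (Nat.hyperfilter_le_atTop (Ici_mem_atTop N))
        (subset_preimage_image ν _)
    · rintro _ ⟨m, hm, rfl⟩ _ ⟨n, hn, rfl⟩
      exact hN m hm n hn) μ hμ (clusterPt_vagueTopology htend)
  exact ⟨μ, hμE, hlim, htend⟩

end Vague

/-! ### Quasiclosed sets yield strongly closed cones -/

section Closedness

variable {X : Type*} [TopologicalSpace X] [MeasurableSpace X] [LocallyCompactSpace X] [T2Space X]
  [BorelSpace X] {κ : X → X → EReal} {A : Set X}

namespace IsPerfect

variable (hκ : IsPerfect κ)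
include hκ

theorem exists_measure_univ_le (hcap : innerCap κ A < ⊤) (Q : ℝ) :
    ∃ M : ℝ≥0, ∀ ν ∈ EPlusOn κ A, mutualEnergy κ ν ν ≤ Q → ν univ ≤ M := by
  have hw : minEnergy κ A ≠ 0 := (ENNReal.inv_lt_top.1 hcap).ne'
  have hfin : ENNReal.ofReal Q / minEnergy κ A ≠ ⊤ := ENNReal.div_ne_top ENNReal.ofReal_ne_top hw
  refine ⟨max 1 (ENNReal.ofReal Q / minEnergy κ A).toNNReal, fun ν hν hQ => ?_⟩
  rw [ENNReal.coe_max, ENNReal.coe_toNNReal hfin, ENNReal.coe_one]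
  rcases le_total (ν univ) 1 with h1 | h1
  · exact le_max_of_le_left h1
  refine le_max_of_le_right ?_
  rw [ENNReal.le_div_iff_mul_le (.inl hw) (.inr ENNReal.ofReal_ne_top), mul_comm]
  calc minEnergy κ A * ν univ ≤ minEnergy κ A * ν univ ^ 2 := by
        gcongr
        rw [sq]
        exact le_mul_of_one_le_left' h1
    _ ≤ ENNReal.ofReal (mutualEnergy κ ν ν) :=
        hκ.minEnergy_mul_sq_le hν (hκ.measure_univ_ne_top hcap hν)
    _ ≤ ENNReal.ofReal Q := ENNReal.ofReal_le_ofReal hQ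

/-- Measures of bounded energy and mass charge sets of small capacity only little. -/
theorem exists_forall_measure_le (Q : ℝ) (M : ℝ≥0) {δ : ℝ≥0∞} (hδ : δ ≠ 0) :
    ∃ ε : ℝ≥0∞, ε ≠ 0 ∧ ∀ D : Set X, IsOpen D → innerCap κ D < ε → ∀ ν ∈ EPlus κ,
      mutualEnergy κ ν ν ≤ Q → ν univ ≤ M → ν D ≤ δ := by
  obtain ⟨C, -, hC⟩ := hκ.exists_minEnergy_mul_sq_le
  set B : ℝ≥0∞ := ENNReal.ofReal Q + C * M ^ 2 with hB
  have hBfin : B ≠ ⊤ := ENNReal.add_ne_top.2 ⟨ENNReal.ofReal_ne_top, by finiteness⟩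
  -- For compact `K ⊆ D` the energy bound reads `ν(K)² ≤ c_*(D) B`. Using `B + 1` keeps the divisor
  -- nonzero.
  refine ⟨δ ^ 2 / (B + 1), (ENNReal.div_pos (pow_ne_zero 2 hδ) (by finiteness)).ne',
    fun D hD hDε ν hν hQ hM => ?_⟩
  have := hν.1
  rw [hD.measure_eq_iSup_isCompact]
  refine iSup_le fun K => iSup_le fun hKD => iSup_le fun hK => ?_
  have hempty : Dᶜ ∩ K = ∅ := by
    ext x
    simp only [mem_inter_iff, mem_compl_iff, mem_empty_iff_false, iff_false, not_and]
    exact fun hx hxK => hx (hKD hxK)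
  have h1 : minEnergy κ D * ν K ^ 2 ≤ B := by
    refine (hC D K ν hν hK (by rw [hempty, measure_empty])).trans ?_
    rw [hB]
    gcongr
  have h2 : (minEnergy κ D)⁻¹ * (B + 1) ≤ δ ^ 2 := by
    calc (minEnergy κ D)⁻¹ * (B + 1) ≤ δ ^ 2 / (B + 1) * (B + 1) := by
          gcongr
          exact hDε.le
      _ = δ ^ 2 := ENNReal.div_mul_cancel (by simp) (by finiteness)
  have hw0 : minEnergy κ D ≠ 0 := by
    intro h0
    rw [innerCap, h0, ENNReal.inv_zero] at hDε
    exact not_top_lt hDε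
  have h3 : ν K ^ 2 ≤ (minEnergy κ D)⁻¹ * B := by
    rcases eq_or_ne (minEnergy κ D) ⊤ with htop | htop
    · rw [htop] at h1
      have : ν K ^ 2 = 0 := by
        by_contra h0
        rw [ENNReal.top_mul h0, top_le_iff] at h1
        exact hBfin h1
      rw [this]
      exact zero_le
    · rw [mul_comm, ← div_eq_mul_inv, ENNReal.le_div_iff_mul_le (.inl hw0) (.inl htop), mul_comm]
      exact h1
  have h4 : ν K ^ 2 ≤ δ ^ 2 := h3.trans ((by gcongr; exact le_self_add : _ ≤ _).trans h2)
  exact (ENNReal.pow_le_pow_left_iff two_ne_zero).1 h4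

theorem cauchy_of_strongDist_lt {ν : ℕ → Measure X} {μ : Measure X} (hν : ∀ n, ν n ∈ EPlus κ)
    (hμ : μ ∈ EPlus κ) (h : Tendsto (fun n => strongDist κ μ (ν n)) atTop (𝓝 0)) :
    ∀ ε : ℝ, 0 < ε → ∃ N, ∀ m ≥ N, ∀ n ≥ N, strongDist κ (ν m) (ν n) < ε := by
  intro ε hε
  obtain ⟨N, hN⟩ := eventually_atTop.1 (h.eventually (gt_mem_nhds (half_pos hε)))
  refine ⟨N, fun m hm n hn => ?_⟩
  have hsq := hκ.strongDist_sq_le (hν m) (hν n) hμ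
  rw [hκ.strongDist_comm (hν m) hμ, hκ.strongDist_comm (hν n) hμ] at hsq
  have h0 : ∀ i, 0 ≤ strongDist κ μ (ν i) := fun i => Real.sqrt_nonneg _
  refine lt_of_pow_lt_pow_left₀ 2 hε.le ?_
  have h1 := pow_lt_pow_left₀ (hN m hm) (h0 m) two_ne_zero
  have h2 := pow_lt_pow_left₀ (hN n hn) (h0 n) two_ne_zero
  nlinarith

theorem isStronglyClosed_of_isQuasiclosed (hcap : innerCap κ A < ⊤) (hA : IsQuasiclosed κ A) :
    IsStronglyClosed κ (EPlusOn κ A) := by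
  intro μ hμ happrox
  choose ν hνA hνd using fun n : ℕ => happrox (1 / ((n : ℝ) + 1)) (by positivity)
  have hνE : ∀ n, ν n ∈ EPlus κ := fun n => (hνA n).1
  have hd0 : ∀ n, 0 ≤ strongDist κ μ (ν n) := fun n => Real.sqrt_nonneg _
  have hd : Tendsto (fun n => strongDist κ μ (ν n)) atTop (𝓝 0) :=
    squeeze_zero hd0 (fun n => (hνd n).le) tendsto_one_div_add_atTop_nhds_zero_nat
  obtain ⟨Q, hQ⟩ : ∃ Q : ℝ, ∀ n, mutualEnergy κ (ν n) (ν n) ≤ Q := by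
    refine ⟨2 * mutualEnergy κ μ μ + 2, fun n => ?_⟩
    have h1 := hκ.mutualEnergy_self_le (hνE n) hμ one_pos
    rw [hκ.strongDist_comm (hνE n) hμ] at h1
    have h2 : strongDist κ μ (ν n) ≤ 1 := (hνd n).le.trans (by
      rw [div_le_one (by positivity)]
      simp)
    have h3 := pow_le_one₀ (n := 2) (hd0 n) h2
    norm_num at h1
    linarith
  obtain ⟨M, hM⟩ := hκ.exists_measure_univ_le hcap Q
  have hνM : ∀ n, ν n univ ≤ M := fun n => hM _ (hνA n) (hQ n)
  obtain ⟨μ', hμ', hd', hvague⟩ :=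
    hκ.exists_strong_limit hνE hνM (hκ.cauchy_of_strongDist_lt hνE hμ hd)
  -- Vague convergence is known only towards `μ'`; the energy principle identifies it with the given
  -- strong limit.
  obtain rfl : μ' = μ := by
    refine hκ.energyPrinciple μ' hμ' μ hμ ?_
    have hlim : Tendsto (fun n => 2 * strongDist κ (ν n) μ' ^ 2 + 2 * strongDist κ μ (ν n) ^ 2)
        (hyperfilter ℕ : Filter ℕ) (𝓝 (2 * 0 ^ 2 + 2 * 0 ^ 2)) :=
      ((hd'.pow 2).const_mul 2).add
        (((hd.mono_left Nat.hyperfilter_le_atTop).pow 2).const_mul 2)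
    have hle : strongDist κ μ' μ ^ 2 ≤ 2 * 0 ^ 2 + 2 * 0 ^ 2 := by
      refine ge_of_tendsto' hlim fun n => ?_
      rw [hκ.strongDist_comm (hνE n) hμ']
      exact hκ.strongDist_sq_le hμ' hμ (hνE n)
    have h0 : strongDist κ μ' μ ^ 2 = 0 := le_antisymm (by simpa using hle) (sq_nonneg _)
    exact pow_eq_zero_iff two_ne_zero |>.1 h0
  refine ⟨hμ, concentratedOn_of_measure_compl_eq_zero ?_⟩
  have := hμ.1
  have hopen : ∀ U : Set X, IsOpen U → ∀ a : ℝ≥0∞, (∀ n, ν n U ≤ a) → μ' U ≤ a := fun U hU a ha =>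
    measure_isOpen_le_of_tendsto_integral (fun n => (hνE n).1) hvague hU ha
  refine le_antisymm (le_of_forall_pos_le_add fun δ hδ => ?_) zero_le
  obtain ⟨ε, hε, hsmall⟩ := hκ.exists_forall_measure_le Q M (ENNReal.half_pos hδ.ne').ne'
  -- Outside `A` every point lies in `Fᶜ` or in `D`. Both are open, so the uniform bounds on the `ν
  -- n` pass to the vague limit.
  obtain ⟨F, hF, hFε⟩ : ∃ F : Set X, IsClosed F ∧ outerCap κ (symmDiff A F) < ε := by
    have := hA.trans_lt (pos_iff_ne_zero.2 hε)
    simpa [iInf_lt_iff] using this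
  obtain ⟨D, ⟨hD, hFD⟩, hDε⟩ : ∃ D : Set X, (IsOpen D ∧ symmDiff A F ⊆ D) ∧ innerCap κ D < ε := by
    simpa only [outerCap, iInf_lt_iff, mem_ofPred_eq, exists_prop] using hFε
  have hνD : ∀ n, ν n D ≤ δ / 2 := fun n => hsmall D hD hDε _ (hνE n) (hQ n) (hνM n)
  have hνF : ∀ n, ν n Fᶜ ≤ δ / 2 := fun n => by
    have hnull : ν n Aᶜ = 0 :=
      (hνA n).2.measure_compl_eq_zero (hνE n).1 ((hνM n).trans_lt ENNReal.coe_lt_top).ne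
    calc ν n Fᶜ ≤ ν n (Aᶜ ∪ D) := measure_mono fun x hx => by
          by_cases hxA : x ∈ A
          · exact Or.inr (hFD (Or.inl ⟨hxA, hx⟩))
          · exact Or.inl hxA
      _ ≤ ν n Aᶜ + ν n D := measure_union_le _ _
      _ ≤ δ / 2 := by rw [hnull, zero_add]; exact hνD n
  calc μ' Aᶜ ≤ μ' (Fᶜ ∪ D) := measure_mono fun x hx => by
        by_cases hxF : x ∈ F
        · exact Or.inr (hFD (Or.inr ⟨hxF, hx⟩))
        · exact Or.inl hxF
    _ ≤ μ' Fᶜ + μ' D := measure_union_le _ _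
    _ ≤ δ / 2 + δ / 2 := add_le_add (hopen _ hF.isOpen_compl _ hνF) (hopen _ hD _ hνD)
    _ = 0 + δ := by rw [ENNReal.add_halves, zero_add]

end IsPerfect

end Closedness

/-! ### Energy estimates against escape of mass -/

section Equilibrium

theorem minEnergy_anti {X : Type*} [TopologicalSpace X] [MeasurableSpace X]
    (κ : X → X → EReal) {A B : Set X} (h : A ⊆ B) : minEnergy κ B ≤ minEnergy κ A :=
  biInf_mono fun _ hν => ⟨⟨hν.1.1, hν.1.2.mono h⟩, hν.2⟩

theorem NearlyEverywhereOn.mono {X : Type*} [TopologicalSpace X] [MeasurableSpace X]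
    {κ : X → X → EReal} {A : Set X} {p q : X → Prop} (h : NearlyEverywhereOn κ A p)
    (hpq : ∀ x, p x → q x) : NearlyEverywhereOn κ A q := by
  have h1 : minEnergy κ {x | x ∈ A ∧ ¬ p x} = ⊤ := ENNReal.inv_eq_zero.1 h
  refine ENNReal.inv_eq_zero.2 (top_le_iff.1 ?_)
  rw [← h1]
  exact minEnergy_anti κ fun x hx => ⟨hx.1, fun hp => hx.2 (hpq x hp)⟩

variable {X : Type*} [TopologicalSpace X] [MeasurableSpace X] [LocallyCompactSpace X] [T2Space X]
  [BorelSpace X] {κ : X → X → EReal} {A : Set X}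

namespace IsPerfect

variable (hκ : IsPerfect κ)
include hκ

theorem minEnergy_toReal_mul_sq_le {ν : Measure X} (hν : ν ∈ EPlusOn κ A) (hfin : ν univ ≠ ⊤) :
    (minEnergy κ A).toReal * ν.real univ ^ 2 ≤ mutualEnergy κ ν ν := by
  have := ENNReal.toReal_mono ENNReal.ofReal_ne_top (hκ.minEnergy_mul_sq_le hν hfin)
  rwa [ENNReal.toReal_mul, ENNReal.toReal_pow,
    ENNReal.toReal_ofReal (hκ.mutualEnergy_self_nonneg hν.1)] at this

/-- Expansion of `‖tσ + ρ - ν‖² ≥ 0`. -/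
theorem two_mul_mul_sub_le {σ ν ρ : Measure X} (hσ : σ ∈ EPlus κ) (hν : ν ∈ EPlus κ)
    (hρ : ρ ∈ EPlus κ) {t : ℝ} (ht : 0 ≤ t) :
    2 * t * (mutualEnergy κ σ ν - mutualEnergy κ σ ρ) ≤
      t ^ 2 * mutualEnergy κ σ σ + strongDist κ ν ρ ^ 2 := by
  lift t to ℝ≥0 using ht
  have hs := hκ.smul_mem_EPlus hσ t
  have := hκ.two_mul_mutualEnergy_le (hκ.add_mem_EPlus hs hρ) hν
  rw [hκ.mutualEnergy_add_left hs hρ hν, hκ.mutualEnergy_smul_left hσ hν,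
    hκ.mutualEnergy_add_left hs hρ (hκ.add_mem_EPlus hs hρ), hκ.mutualEnergy_add_right hs hs hρ,
    hκ.mutualEnergy_add_right hρ hs hρ, hκ.mutualEnergy_smul_left hσ hs,
    hκ.mutualEnergy_smul_right hσ hσ, hκ.mutualEnergy_smul_left hσ hρ,
    hκ.mutualEnergy_smul_right hρ hσ, hκ.mutualEnergy_comm hρ hσ, hκ.mutualEnergy_comm hρ hν]
    at this
  rw [hκ.strongDist_sq hν hρ]
  linarith

theorem mutualEnergy_mono {k : X → X → ℝ≥0∞} (h : IsShift κ k 0) {μ μ' ν ν' : Measure X}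
    (hμ : μ ∈ EPlus κ) (hμ' : μ' ∈ EPlus κ) (hν : ν ∈ EPlus κ) (hν' : ν' ∈ EPlus κ)
    (hle : μ ≤ μ') (hle' : ν ≤ ν') : mutualEnergy κ μ ν ≤ mutualEnergy κ μ' ν' := by
  rw [h.mutualEnergy_eq hκ.positiveDefinite hμ hν, h.mutualEnergy_eq hκ.positiveDefinite hμ' hν']
  have key : lenergy k μ ν ≤ lenergy k μ' ν' :=
    lintegral_mono' hle' fun x => lintegral_mono' hle le_rfl
  simpa using ENNReal.toReal_mono (h.lenergy_ne_top hκ.positiveDefinite hμ' hν') key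

/-- The potential of `ρ` is lower semicontinuous, hence a directed supremum of such `φ`, and
`τ`-additivity carries the supremum through the integral. -/
theorem exists_ccMinorant_lt {k : X → X → ℝ≥0∞} (h : IsShift κ k 0) {ρ : Measure X}
    (hρ : ρ ∈ EPlus κ) {ε : ℝ} (hε : 0 < ε) :
    ∃ φ : CcMinorant fun x => ∫⁻ y, k x y ∂ρ, mutualEnergy κ ρ ρ - ε < ∫ x, φ.1 x ∂ρ := by
  have := hρ.1
  have hfin := h.lenergy_ne_top hκ.positiveDefinite hρ hρ
  have hlsc := lowerSemicontinuous_lintegral_section ρ h.lsc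
  have heq : lenergy k ρ ρ = ⨆ φ : CcMinorant fun x => ∫⁻ y, k x y ∂ρ,
      ENNReal.ofReal (∫ x, φ.1 x ∂ρ) := by
    calc lenergy k ρ ρ = ∫⁻ x, ⨆ φ : CcMinorant fun x => ∫⁻ y, k x y ∂ρ,
          ENNReal.ofReal (φ.1 x) ∂ρ := lintegral_congr fun x => (CcMinorant.iSup_eq hlsc x).symm
      _ = ⨆ φ : CcMinorant fun x => ∫⁻ y, k x y ∂ρ, ∫⁻ x, ENNReal.ofReal (φ.1 x) ∂ρ :=
          lintegral_iSup_of_directed_lsc ρ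
            (fun φ => (ENNReal.continuous_ofReal.comp φ.1.continuous).lowerSemicontinuous)
            (CcMinorant.directed _)
      _ = _ := iSup_congr fun φ =>
          lintegral_ofReal_eq_of_hasCompactSupport ρ φ.1.continuous φ.2.1 φ.2.2.1
  have hreal : mutualEnergy κ ρ ρ = (lenergy k ρ ρ).toReal := by
    rw [h.mutualEnergy_eq hκ.positiveDefinite hρ hρ]
    simp
  by_contra! hcon
  have hle : lenergy k ρ ρ ≤ ENNReal.ofReal (mutualEnergy κ ρ ρ - ε) := by
    rw [heq]
    exact iSup_le fun φ => ENNReal.ofReal_le_ofReal (hcon φ)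
  have h0 : 0 ≤ mutualEnergy κ ρ ρ - ε :=
    (integral_nonneg fun x => (Classical.arbitrary
      (CcMinorant fun x => ∫⁻ y, k x y ∂ρ)).2.2.1 x).trans (hcon _)
  have := ENNReal.toReal_le_of_le_ofReal h0 hle
  linarith

/-- If `ν` has unit mass, `ρ` is close to `ν` in energy, and most of the energy of `ρ` is seen by a
continuous function `φ` below its potential, then `ν` has little mass outside the support of `φ`. -/
theorem mul_one_sub_sq_le {k : X → X → ℝ≥0∞} (h : IsShift κ k 0) {ν ρ : Measure X}
    (hν : ν ∈ EPlusOn κ A) (h1 : ν univ = 1) (hρ : ρ ∈ EPlus κ)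
    (φ : CcMinorant fun x => ∫⁻ y, k x y ∂ρ) {f : X → ℝ} (hf : Continuous f)
    (hfc : HasCompactSupport f) (hf01 : ∀ x, f x ∈ Icc (0 : ℝ) 1)
    (hfφ : ∀ x ∈ tsupport φ.1, f x = 1) (hf1 : ∫ x, f x ∂ν ≤ 1) {t : ℝ} (ht : 0 < t) :
    2 * t * ((minEnergy κ A).toReal * (1 - ∫ x, f x ∂ν) ^ 2) ≤
      2 * t * (mutualEnergy κ ν ρ - ∫ x, φ.1 x ∂ν) + t ^ 2 * mutualEnergy κ ν ν +
        strongDist κ ν ρ ^ 2 := by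
  have hfin : IsFiniteMeasure ν := ⟨by simp [h1]⟩
  set K := tsupport φ.1 with hK
  have hKm : MeasurableSet K := (isClosed_tsupport _).measurableSet
  have hint := hf.integrable_of_hasCompactSupport hfc (μ := ν)
  have hσ : ν.restrict Kᶜ ∈ EPlus κ := hκ.restrict_mem_EPlus hν.1 (measure_ne_top ν _)
  have hτ : ν.restrict K ∈ EPlus κ := hκ.restrict_mem_EPlus hν.1 (measure_ne_top ν _)
  have hle : ν.restrict Kᶜ ≤ ν := Measure.restrict_le_self
  have hσν := hκ.mutualEnergy_mono h hσ hσ hσ hν.1 le_rfl hle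
  have hσσ := hκ.mutualEnergy_mono h hσ hν.1 hσ hν.1 hle hle
  have hmass := hκ.minEnergy_toReal_mul_sq_le (A := A) (ν := ν.restrict Kᶜ)
    ⟨hσ, hν.2.restrict _⟩ (measure_ne_top _ _)
  have hKf : ν.real K ≤ ∫ x, f x ∂ν := by
    rw [← integral_indicator_one hKm]
    refine integral_mono ((integrable_const 1).indicator hKm) hint fun x => ?_
    by_cases hx : x ∈ K
    · simp [hx, hfφ x hx]
    · simpa [hx] using (hf01 x).1
  have huniv : (ν.restrict Kᶜ).real univ = 1 - ν.real K := by
    rw [measureReal_restrict_apply_univ, measureReal_compl hKm]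
    simp [Measure.real, h1]
  have hsq : (1 - ∫ x, f x ∂ν) ^ 2 ≤ (ν.restrict Kᶜ).real univ ^ 2 := by
    rw [huniv]
    exact pow_le_pow_left₀ (by linarith) (by linarith) 2
  have hsq' := mul_le_mul_of_nonneg_left hsq (ENNReal.toReal_nonneg (a := minEnergy κ A))
  have hsum : mutualEnergy κ ν ρ =
      mutualEnergy κ (ν.restrict K) ρ + mutualEnergy κ (ν.restrict Kᶜ) ρ := by
    rw [← hκ.mutualEnergy_add_left hτ hσ hρ, Measure.restrict_add_restrict_compl hKm]
  -- Since `φ` lives on `K` and lies below the potential of `ρ`, the part of `ν` on `K` accounts for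
  -- at least `∫ φ dν` of the mutual energy with `ρ`, leaving little for the part outside `K`.
  have hφ : ∫ x, φ.1 x ∂ν ≤ mutualEnergy κ (ν.restrict K) ρ := by
    rw [hκ.mutualEnergy_comm hτ hρ, h.mutualEnergy_eq hκ.positiveDefinite hρ hτ]
    simp only [NNReal.coe_zero, zero_mul, sub_zero]
    refine (ENNReal.ofReal_le_iff_le_toReal
      (h.lenergy_ne_top hκ.positiveDefinite hρ hτ)).1 ?_
    rw [← lintegral_ofReal_eq_of_hasCompactSupport ν φ.1.continuous φ.2.1 φ.2.2.1,
      ← setLIntegral_eq_of_support_subset]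
    · exact lintegral_mono fun x => φ.2.2.2 x
    · intro x hx
      refine subset_tsupport _ fun h0 => hx ?_
      simp [h0]
  have hmain := hκ.two_mul_mul_sub_le hσ hν.1 hρ ht.le
  nlinarith [mul_le_mul_of_nonneg_left hσσ (sq_nonneg t),
    mul_le_mul_of_nonneg_left (hsq'.trans (hmass.trans hσν)) ht.le,
    mul_le_mul_of_nonneg_left hφ ht.le]

end IsPerfect

end Equilibrium

/-! ### Existence of the equilibrium measure -/

section Existence

theorem le_of_forall_le_one_add_mul {a b : ℝ} (h : ∀ t : ℝ, 0 < t → a ≤ (1 + t) * b) : a ≤ b := by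
  have hlim : Tendsto (fun t : ℝ => (1 + t) * b) (𝓝[>] 0) (𝓝 ((1 + 0) * b)) :=
    Tendsto.mono_left (Continuous.tendsto (by fun_prop) 0) nhdsWithin_le_nhds
  rw [add_zero, one_mul] at hlim
  exact ge_of_tendsto hlim (eventually_nhdsWithin_of_forall fun t ht => h t ht)

theorem integral_le_real_univ {X : Type*} [TopologicalSpace X] [MeasurableSpace X]
    [OpensMeasurableSpace X] (ν : Measure X) [IsFiniteMeasure ν] {f : X → ℝ} (hf : Continuous f)
    (hfc : HasCompactSupport f) (hf1 : ∀ x, f x ≤ 1) : ∫ x, f x ∂ν ≤ ν.real univ := by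
  have := integral_mono (hf.integrable_of_hasCompactSupport hfc (μ := ν)) (integrable_const 1) hf1
  simpa using this

variable {X : Type*} [TopologicalSpace X] [MeasurableSpace X] [LocallyCompactSpace X] [T2Space X]
  [BorelSpace X] {κ : X → X → EReal} {A : Set X}

namespace IsPerfect

variable (hκ : IsPerfect κ)
include hκ

theorem mutualEnergy_self_eq_of_tendsto {ι : Type*} {l : Filter ι} [l.NeBot] {ν : ι → Measure X}
    {ρ : Measure X} {w : ℝ} (hν : ∀ i, ν i ∈ EPlus κ) (hρ : ρ ∈ EPlus κ)
    (hd : Tendsto (fun i => strongDist κ (ν i) ρ) l (𝓝 0))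
    (hq : Tendsto (fun i => mutualEnergy κ (ν i) (ν i)) l (𝓝 w)) : mutualEnergy κ ρ ρ = w := by
  have hd2 : ∀ t : ℝ, Tendsto (fun i => (1 + t⁻¹) * strongDist κ (ν i) ρ ^ 2) l (𝓝 0) := fun t => by
    simpa using (hd.pow 2).const_mul (1 + t⁻¹)
  refine le_antisymm (le_of_forall_le_one_add_mul fun t ht => ?_)
    (le_of_forall_le_one_add_mul fun t ht => ?_)
  · have hlim := (hq.const_mul (1 + t)).add (hd2 t)
    rw [add_zero] at hlim
    refine ge_of_tendsto' hlim fun i => ?_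
    rw [hκ.strongDist_comm (hν i) hρ]
    exact hκ.mutualEnergy_self_le hρ (hν i) ht
  · have hlim := (hd2 t).const_add ((1 + t) * mutualEnergy κ ρ ρ)
    rw [add_zero] at hlim
    exact le_of_tendsto_of_tendsto' hq hlim fun i => hκ.mutualEnergy_self_le (hν i) hρ ht

theorem exists_tendsto_minEnergy (hw : minEnergy κ A ≠ ⊤) :
    ∃ ν : ℕ → Measure X, (∀ n, ν n ∈ EPlusOn κ A) ∧ (∀ n, ν n univ = 1) ∧
      ∀ n : ℕ, mutualEnergy κ (ν n) (ν n) < (minEnergy κ A).toReal + 1 / ((n : ℝ) + 1) := by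
  have key : ∀ n : ℕ, ∃ ν ∈ EPlusOn κ A, ν univ = 1 ∧
      mutualEnergy κ ν ν < (minEnergy κ A).toReal + 1 / ((n : ℝ) + 1) := by
    intro n
    have hpos : (0 : ℝ) < 1 / ((n : ℝ) + 1) := by positivity
    have hlt : minEnergy κ A < ENNReal.ofReal ((minEnergy κ A).toReal + 1 / ((n : ℝ) + 1)) := by
      rw [ENNReal.lt_ofReal_iff_toReal_lt hw]
      linarith
    obtain ⟨ν, hν⟩ := iInf_lt_iff.1 hlt
    obtain ⟨⟨hνA, hν1⟩, hνlt⟩ := iInf_lt_iff.1 hν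
    refine ⟨ν, hνA, hν1, ?_⟩
    rw [hκ.coe_mutualEnergy hνA.1 hνA.1, EReal.real_coe_toENNReal] at hνlt
    exact (ENNReal.ofReal_lt_ofReal_iff_of_nonneg (hκ.mutualEnergy_self_nonneg hνA.1)).1 hνlt
  choose ν h1 h2 h3 using key
  exact ⟨ν, h1, h2, h3⟩

/-- Since `μ + ν` has mass two, `‖μ + ν‖² ≥ 4w`; the parallelogram law does the rest. -/
theorem strongDist_sq_le_of_unit {μ ν : Measure X} (hμ : μ ∈ EPlusOn κ A) (hν : ν ∈ EPlusOn κ A)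
    (hμ1 : μ univ = 1) (hν1 : ν univ = 1) : strongDist κ μ ν ^ 2 ≤
      2 * (mutualEnergy κ μ μ - (minEnergy κ A).toReal) +
        2 * (mutualEnergy κ ν ν - (minEnergy κ A).toReal) := by
  have hfin : (μ + ν) univ ≠ ⊤ := by simp [hμ1, hν1]
  have h := hκ.minEnergy_toReal_mul_sq_le (hκ.add_mem_EPlusOn hμ hν) hfin
  have h2 : (μ + ν).real univ = 2 := by
    simp [Measure.real, hμ1, hν1]
    norm_num
  rw [h2, hκ.mutualEnergy_add_left hμ.1 hν.1 (hκ.add_mem_EPlus hμ.1 hν.1),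
    hκ.mutualEnergy_add_right hμ.1 hμ.1 hν.1, hκ.mutualEnergy_add_right hν.1 hμ.1 hν.1,
    hκ.mutualEnergy_comm hν.1 hμ.1] at h
  rw [hκ.strongDist_sq hμ.1 hν.1]
  linarith

/-- No mass escapes to infinity along an energy minimizing sequence. -/
theorem one_le_real_univ_of_tendsto {ι : Type*} {l : Filter ι} [l.NeBot] {ν : ι → Measure X}
    {ρ : Measure X} (hw0 : 0 < (minEnergy κ A).toReal) (hν : ∀ i, ν i ∈ EPlusOn κ A)
    (h1 : ∀ i, ν i univ = 1) (hρ : ρ ∈ EPlus κ) (hρ1 : ρ univ ≤ 1)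
    (hd : Tendsto (fun i => strongDist κ (ν i) ρ) l (𝓝 0))
    (hq : Tendsto (fun i => mutualEnergy κ (ν i) (ν i)) l (𝓝 (minEnergy κ A).toReal))
    (hvague : ∀ f : C_c(X, ℝ), Tendsto (fun i => ∫ x, f x ∂(ν i)) l (𝓝 (∫ x, f x ∂ρ))) :
    1 ≤ ρ.real univ := by
  have hνfin : ∀ i, IsFiniteMeasure (ν i) := fun i => ⟨by simp [h1 i]⟩
  have hρfin : IsFiniteMeasure ρ := ⟨hρ1.trans_lt ENNReal.one_lt_top⟩
  have hνr : ∀ i, (ν i).real univ = 1 := fun i => by simp [Measure.real, h1 i]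
  have hρr : ρ.real univ ≤ 1 := by
    simpa [Measure.real] using ENNReal.toReal_mono ENNReal.one_ne_top hρ1
  obtain ⟨k, C, h⟩ := hκ.isKernel.exists_isShift
  by_cases hX : CompactSpace X
  -- On compact `X` the constant `1` is a test function, so vague limits preserve mass.
  · let e : C_c(X, ℝ) := ⟨⟨fun _ => 1, continuous_const⟩, HasCompactSupport.of_compactSpace _⟩
    have he : ∀ μ : Measure X, ∫ x, e x ∂μ = μ.real univ := fun μ => by
      change ∫ _, (1 : ℝ) ∂μ = _
      simp
    have := hvague e
    simp_rw [he, hνr] at this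
    exact (tendsto_nhds_unique this tendsto_const_nhds).ge
  obtain rfl : C = 0 := h.compact.resolve_right hX
  set w := (minEnergy κ A).toReal
  have hqρ : mutualEnergy κ ρ ρ = w :=
    hκ.mutualEnergy_self_eq_of_tendsto (fun i => (hν i).1) hρ hd hq
  have hcross : Tendsto (fun i => mutualEnergy κ (ν i) ρ) l (𝓝 w) := by
    have hlim := ((hq.add_const (mutualEnergy κ ρ ρ)).sub (hd.pow 2)).div_const 2
    have hval : (w + mutualEnergy κ ρ ρ - 0 ^ 2) / 2 = w := by rw [hqρ]; ring
    rw [hval] at hlim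
    refine hlim.congr fun i => ?_
    rw [hκ.strongDist_sq (hν i).1 hρ]
    ring
  have key : ∀ t : ℝ, 0 < t → w * (1 - ρ.real univ) ^ 2 ≤ (1 + t) * 0 + t * (1 + w) := by
    intro t ht
    -- The energy error is taken equal to the variation parameter `t`, so that division by `2t`
    -- leaves a bound of order `t`.
    obtain ⟨φ, hφ⟩ := hκ.exists_ccMinorant_lt h hρ ht
    obtain ⟨f, hfK, hfc, -, hf01⟩ := exists_continuousMap_one_of_isCompact_subset_isOpen
      φ.2.1.isCompact isOpen_univ (subset_univ _)
    have hf1 : ∀ x, f x ≤ 1 := fun x => (hf01 x).2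
    have hlimf := hvague ⟨f, hfc⟩
    have hlimφ := hvague ⟨φ.1, φ.2.1⟩
    change Tendsto (fun i => ∫ x, f x ∂(ν i)) l (𝓝 (∫ x, f x ∂ρ)) at hlimf
    change Tendsto (fun i => ∫ x, φ.1 x ∂(ν i)) l (𝓝 (∫ x, φ.1 x ∂ρ)) at hlimφ
    have hL : Tendsto (fun i => 2 * t * (w * (1 - ∫ x, f x ∂(ν i)) ^ 2)) l
        (𝓝 (2 * t * (w * (1 - ∫ x, f x ∂ρ) ^ 2))) :=
      (((hlimf.const_sub 1).pow 2).const_mul w).const_mul (2 * t)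
    have hR : Tendsto (fun i => 2 * t * (mutualEnergy κ (ν i) ρ - ∫ x, φ.1 x ∂(ν i)) +
        t ^ 2 * mutualEnergy κ (ν i) (ν i) + strongDist κ (ν i) ρ ^ 2) l
        (𝓝 (2 * t * (w - ∫ x, φ.1 x ∂ρ) + t ^ 2 * w + 0 ^ 2)) :=
      (((hcross.sub hlimφ).const_mul (2 * t)).add (hq.const_mul (t ^ 2))).add (hd.pow 2)
    have hle := le_of_tendsto_of_tendsto' hL hR fun i =>
      hκ.mul_one_sub_sq_le h (hν i) (h1 i) hρ φ f.continuous hfc hf01 hfK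
        ((integral_le_real_univ (ν i) f.continuous hfc hf1).trans (hνr i).le) ht
    have hfρ := integral_le_real_univ ρ f.continuous hfc hf1
    have hsq : w * (1 - ρ.real univ) ^ 2 ≤ w * (1 - ∫ x, f x ∂ρ) ^ 2 := by
      refine mul_le_mul_of_nonneg_left (pow_le_pow_left₀ (by linarith) (by linarith) 2) hw0.le
    have h2t : 2 * t * (w * (1 - ρ.real univ) ^ 2) ≤ 2 * t * (t * (1 + w)) := by
      have h3 := mul_le_mul_of_nonneg_left hsq (by positivity : (0 : ℝ) ≤ 2 * t)
      have h4 := mul_le_mul_of_nonneg_left hφ.le (by positivity : (0 : ℝ) ≤ 2 * t)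
      rw [hqρ] at h4
      nlinarith [mul_pos (mul_pos ht ht) hw0]
    rw [mul_zero, zero_add]
    exact le_of_mul_le_mul_left h2t (by positivity)
  have hzero : w * (1 - ρ.real univ) ^ 2 ≤ 0 := by
    have hlim : Tendsto (fun t : ℝ => (1 + t) * 0 + t * (1 + w)) (𝓝[>] 0)
        (𝓝 ((1 + 0) * 0 + 0 * (1 + w))) :=
      Tendsto.mono_left (Continuous.tendsto (by fun_prop) 0) nhdsWithin_le_nhds
    simpa using ge_of_tendsto hlim (eventually_nhdsWithin_of_forall fun t ht => key t ht)
  have hsq0 : (1 - ρ.real univ) ^ 2 ≤ 0 := by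
    by_contra! hcon
    exact absurd hzero (not_le.2 (mul_pos hw0 hcon))
  have := pow_eq_zero_iff two_ne_zero |>.1 (le_antisymm hsq0 (sq_nonneg _))
  linarith

theorem exists_unit_minimizer (hcap : innerCap κ A < ⊤) (hcl : IsStronglyClosed κ (EPlusOn κ A))
    (hw : minEnergy κ A ≠ ⊤) : ∃ ρ ∈ EPlusOn κ A, ρ univ = 1 ∧
      mutualEnergy κ ρ ρ = (minEnergy κ A).toReal := by
  have hw0 : 0 < (minEnergy κ A).toReal := ENNReal.toReal_pos (ENNReal.inv_lt_top.1 hcap).ne' hw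
  obtain ⟨ν, hν, hν1, hνq⟩ := hκ.exists_tendsto_minEnergy hw
  have hνE : ∀ n, ν n ∈ EPlus κ := fun n => (hν n).1
  set w := (minEnergy κ A).toReal
  have hwle : ∀ n, w ≤ mutualEnergy κ (ν n) (ν n) := fun n => by
    have := hκ.minEnergy_toReal_mul_sq_le (hν n) (by simp [hν1 n])
    simpa [Measure.real, hν1 n] using this
  have hqtop : Tendsto (fun n => mutualEnergy κ (ν n) (ν n)) atTop (𝓝 w) := by
    refine tendsto_of_tendsto_of_tendsto_of_le_of_le tendsto_const_nhds ?_ hwle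
      fun n => (hνq n).le
    simpa using (tendsto_one_div_add_atTop_nhds_zero_nat (𝕜 := ℝ)).const_add w
  have hcauchy : ∀ ε : ℝ, 0 < ε → ∃ N, ∀ m ≥ N, ∀ n ≥ N, strongDist κ (ν m) (ν n) < ε := by
    intro ε hε
    obtain ⟨N, hN⟩ := eventually_atTop.1
      (hqtop.eventually (gt_mem_nhds (by linarith [pow_pos hε 2] : w < w + ε ^ 2 / 4)))
    refine ⟨N, fun m hm n hn => lt_of_pow_lt_pow_left₀ 2 hε.le ?_⟩
    have := hκ.strongDist_sq_le_of_unit (hν m) (hν n) (hν1 m) (hν1 n)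
    linarith [hN m hm, hN n hn]
  obtain ⟨ρ, hρ, hd, hvague⟩ := hκ.exists_strong_limit (M := 1) hνE (fun n => by simp [hν1 n])
    hcauchy
  have hq := hqtop.mono_left Nat.hyperfilter_le_atTop
  have hρA : ρ ∈ EPlusOn κ A := by
    refine hcl ρ hρ fun ε hε => ?_
    obtain ⟨n, hn⟩ := (hd.eventually (gt_mem_nhds hε)).exists
    exact ⟨ν n, hν n, by rwa [hκ.strongDist_comm hρ (hνE n)]⟩
  have := hρ.1
  have hρ1 : ρ univ ≤ 1 := measure_isOpen_le_of_tendsto_integral (fun n => (hνE n).1) hvague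
    isOpen_univ fun n => (hν1 n).le
  have hone := hκ.one_le_real_univ_of_tendsto hw0 hν hν1 hρ hρ1 hd hq hvague
  refine ⟨ρ, hρA, le_antisymm hρ1 ?_, hκ.mutualEnergy_self_eq_of_tendsto hνE hρ hd hq⟩
  rw [← ENNReal.ofReal_one]
  exact ENNReal.ofReal_le_of_le_toReal hone

/-- First variation: `w (1 + t)² ≤ ‖ρ + tν‖²` for `t > 0`, divided by `2t`, with `t → 0`. -/
theorem minEnergy_le_mutualEnergy {ρ ν : Measure X} (hρ : ρ ∈ EPlusOn κ A) (hρ1 : ρ univ = 1)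
    (hρq : mutualEnergy κ ρ ρ = (minEnergy κ A).toReal) (hν : ν ∈ EPlusOn κ A)
    (hν1 : ν univ = 1) : (minEnergy κ A).toReal ≤ mutualEnergy κ ρ ν := by
  set w := (minEnergy κ A).toReal with hw
  have key : ∀ t : ℝ, 0 < t → w ≤ mutualEnergy κ ρ ν + t * (mutualEnergy κ ν ν / 2 - w / 2) := by
    intro t ht
    lift t to ℝ≥0 using ht.le
    have ht' : (0 : ℝ) < t := ht
    have hs := hκ.smul_mem_EPlusOn hν t
    have htot : (ρ + t • ν) univ = ((1 + t : ℝ≥0) : ℝ≥0∞) := by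
      rw [Measure.add_apply, Measure.coe_nnreal_smul_apply, hρ1, hν1, mul_one, ENNReal.coe_add,
        ENNReal.coe_one]
    have hfin : (ρ + t • ν) univ ≠ ⊤ := htot ▸ ENNReal.coe_ne_top
    have hm : (ρ + t • ν).real univ = 1 + t := by
      rw [Measure.real, htot, ENNReal.coe_toReal, NNReal.coe_add, NNReal.coe_one]
    have h := hκ.minEnergy_toReal_mul_sq_le (hκ.add_mem_EPlusOn hρ hs) hfin
    rw [hm, hκ.mutualEnergy_add_left hρ.1 hs.1 (hκ.add_mem_EPlus hρ.1 hs.1),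
      hκ.mutualEnergy_add_right hρ.1 hρ.1 hs.1, hκ.mutualEnergy_add_right hs.1 hρ.1 hs.1,
      hκ.mutualEnergy_comm hs.1 hρ.1, hκ.mutualEnergy_smul_left hν.1 hs.1,
      hκ.mutualEnergy_smul_right hν.1 hν.1, hκ.mutualEnergy_smul_right hρ.1 hν.1, hρq, ← hw] at h
    refine le_of_mul_le_mul_left ?_ (by positivity : (0 : ℝ) < 2 * t)
    linarith
  have hlim : Tendsto (fun t : ℝ => mutualEnergy κ ρ ν + t * (mutualEnergy κ ν ν / 2 - w / 2))
      (𝓝[>] 0) (𝓝 (mutualEnergy κ ρ ν + 0 * (mutualEnergy κ ν ν / 2 - w / 2))) :=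
    Tendsto.mono_left (Continuous.tendsto (by fun_prop) 0) nhdsWithin_le_nhds
  simpa using ge_of_tendsto hlim (eventually_nhdsWithin_of_forall fun t ht => key t ht)

/-- Existence of an equilibrium measure on `A`. -/
theorem exists_equilibrium (hcap : innerCap κ A < ⊤) (hcl : IsStronglyClosed κ (EPlusOn κ A)) :
    ∃ γ ∈ EPlusOn κ A, γ univ = innerCap κ A ∧
      mutualEnergy κ γ γ = (innerCap κ A).toReal ∧
      NearlyEverywhereOn κ A fun x => 1 ≤ potential κ γ x := by
  rcases eq_or_ne (minEnergy κ A) ⊤ with hw | hw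
  · have h0 : innerCap κ A = 0 := ENNReal.inv_eq_zero.2 hw
    refine ⟨0, ⟨hκ.zero_mem_EPlus, concentratedOn_zero A⟩, by simp [h0], ?_, ?_⟩
    · rw [hκ.mutualEnergy_zero_left hκ.zero_mem_EPlus, h0, ENNReal.toReal_zero]
    · refine ENNReal.inv_eq_zero.2 (top_le_iff.1 ?_)
      rw [← hw]
      exact minEnergy_anti κ fun x hx => hx.1
  obtain ⟨ρ, hρ, hρ1, hρq⟩ := hκ.exists_unit_minimizer hcap hcl hw
  lift innerCap κ A to ℝ≥0 using hcap.ne with c hc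
  have hw0 : (minEnergy κ A).toReal ≠ 0 :=
    (ENNReal.toReal_pos (fun h0 => by
      rw [innerCap, h0, ENNReal.inv_zero] at hc
      exact ENNReal.coe_ne_top hc) hw).ne'
  have hcw : (c : ℝ) = (minEnergy κ A).toReal⁻¹ := by
    rw [← ENNReal.toReal_inv, ← innerCap, ← hc, ENNReal.coe_toReal]
  have hγ := hκ.smul_mem_EPlusOn hρ c
  refine ⟨c • ρ, hγ, by rw [Measure.coe_nnreal_smul_apply, hρ1, mul_one], ?_, ?_⟩
  · rw [hκ.mutualEnergy_smul_left hρ.1 hγ.1, hκ.mutualEnergy_smul_right hρ.1 hρ.1, hρq,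
      ENNReal.coe_toReal, hcw]
    field_simp
  · refine ENNReal.inv_eq_zero.2 ?_
    simp only [minEnergy, mem_ofPred_eq, iInf_eq_top]
    rintro ν ⟨hν, hν1⟩
    exfalso
    -- A unit measure on the exceptional set would satisfy `κγ < 1` a.e. while `κ(γ, ν) ≥ c w = 1 =
    -- ν(X)`, which forces `κγ = 1` a.e.
    have hνA : ν ∈ EPlusOn κ A := ⟨hν.1, hν.2.mono fun x hx => hx.1⟩
    have hfin : ν univ ≠ ⊤ := by simp [hν1]
    have hnull := hν.2.measure_compl_eq_zero hν.1.1 hfin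
    have hlt : ∀ᵐ x ∂ν, ¬ 1 ≤ potential κ (c • ρ) x := by
      rw [ae_iff]
      refine measure_mono_null ?_ hnull
      rintro x hx ⟨-, hx'⟩
      exact hx hx'
    have hle : ν.real univ ≤ mutualEnergy κ (c • ρ) ν := by
      rw [hκ.mutualEnergy_smul_left hρ.1 hν.1]
      have := hκ.minEnergy_le_mutualEnergy hρ hρ1 hρq hνA hν1
      have h2 := mul_le_mul_of_nonneg_left this c.coe_nonneg
      rw [hcw, inv_mul_cancel₀ hw0, ← hcw] at h2
      simpa [Measure.real, hν1] using h2
    have hone := hκ.ae_eq_one_of_le_one hγ.1 hν.1 hfin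
      (hlt.mono fun x hx => (not_le.1 hx).le) hle
    have hfalse : ∀ᵐ _ ∂ν, False := by
      filter_upwards [hlt, hone] with x hx hx'
      exact hx hx'.ge
    rw [ae_iff] at hfalse
    simp [hν1] at hfalse

end IsPerfect

end Existence

/-! ### The Gauss functional and sets defined by potentials -/

section Extremal

variable {X : Type*} [TopologicalSpace X] [MeasurableSpace X] [LocallyCompactSpace X] [T2Space X]
  [BorelSpace X] {κ : X → X → EReal} {A : Set X} {γ ν : Measure X}

namespace IsPerfect

variable (hκ : IsPerfect κ)
include hκ

theorem gaussG_eq (hν : ν ∈ EPlus κ) (hfin : ν univ ≠ ⊤) :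
    gaussG κ ν = ((2 * ν.real univ - mutualEnergy κ ν ν : ℝ) : EReal) := by
  rw [gaussG, hκ.coe_mutualEnergy hν hν, ← EReal.coe_ennreal_toReal hfin]
  rfl

theorem measurableSet_not_one_le_potential (hν : ν.Regular) :
    MeasurableSet {x | ¬ 1 ≤ potential κ ν x} := by
  simp_rw [not_le]
  exact measurableSet_lt (hκ.lowerSemicontinuous_potential hν).measurable measurable_const

theorem measurableSet_not_potential_eq_one (hν : ν.Regular) :
    MeasurableSet {x | ¬ potential κ ν x = 1} :=
  ((hκ.lowerSemicontinuous_potential hν).measurable (measurableSet_singleton 1)).compl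

/-- The set `{κν > 1}` is open and `ν`-null, hence disjoint from the support. -/
theorem potential_le_one_of_mem_support (hν : ν.Regular) (h : ∀ᵐ x ∂ν, potential κ ν x ≤ 1) :
    ∀ x ∈ ν.support, potential κ ν x ≤ 1 := by
  intro x hx
  by_contra! hlt
  have hopen : IsOpen {y | 1 < potential κ ν y} :=
    (hκ.lowerSemicontinuous_potential hν).isOpen_preimage 1
  refine ((Measure.mem_support_iff_forall x).1 hx _ (hopen.mem_nhds hlt)).ne' ?_
  rw [ae_iff] at h
  simpa only [not_le] using h

end IsPerfect

end Extremal

end PotentialTheory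

end

/-! ### The inner capacitary measure and its characterizations -/

theorem mainTheorem6 {X : Type*} [TopologicalSpace X] [LocallyCompactSpace X] [T2Space X]
    [MeasurableSpace X] [BorelSpace X]
    (κ : X → X → EReal) (hκ : IsPerfect κ)
    (A : Set X) (hcap : innerCap κ A < ⊤)
    (hA : IsStronglyClosed κ (EPlusOn κ A) ∨ IsQuasiclosed κ A) :
    ∃ γ : Measure X,
      -- `γ` is the inner capacitary measure of `A`
      (∀ μ : Measure X, IsInnerCapacitaryMeasure κ A μ ↔ μ = γ) ∧
      γ ∈ EHatOn κ A ∧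
      -- the unique maximizer of `G` over `ℰ⁺_A`
      (∀ μ : Measure X, (μ ∈ EPlusOn κ A ∧ IsMaxOn (gaussG κ) (EPlusOn κ A) μ) ↔ μ = γ) ∧
      gaussG κ γ = ((innerCap κ A : ℝ≥0∞) : EReal) ∧
      -- the unique maximizer of the total mass over the `ν ∈ ℰ⁺_A` with `κν ≤ 1` `ν`-a.e.
      (∀ μ : Measure X,
        (μ ∈ EHatOn κ A ∧ IsMaxOn (fun ν : Measure X => ν univ) (EHatOn κ A) μ) ↔ μ = γ) ∧
      γ univ = innerCap κ A ∧
      -- (a)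
      (∀ μ ∈ EPlusOn κ A,
        (energy κ μ μ ≤ ((μ univ : ℝ≥0∞) : EReal) ∧
          ((innerCap κ A : ℝ≥0∞) : EReal) ≤ energy κ μ μ) ↔ μ = γ) ∧
      -- (b)
      (∀ μ ∈ EPlusOn κ A,
        (NearlyEverywhereOn κ A (fun x => 1 ≤ potential κ μ x) ∧
          ∀ᵐ x ∂μ, potential κ μ x ≤ 1) ↔ μ = γ) ∧
      -- (c)
      (FrostmanPrinciple κ → ∀ μ ∈ EPlusOn κ A,
        NearlyEverywhereOn κ A (fun x => potential κ μ x = 1) ↔ μ = γ) := by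

  have hcl : IsStronglyClosed κ (EPlusOn κ A) :=
    hA.elim id (hκ.isStronglyClosed_of_isQuasiclosed hcap)
  obtain ⟨γ, hγ, hγm, hγq, hγne⟩ := hκ.exists_equilibrium hcap hcl
  have hfin : ∀ ν ∈ EPlusOn κ A, ν univ ≠ ⊤ := fun ν hν => hκ.measure_univ_ne_top hcap hν
  set c := (innerCap κ A).toReal with hc
  have hcc : ((innerCap κ A : ℝ≥0∞) : EReal) = (c : EReal) :=
    (EReal.coe_ennreal_toReal hcap.ne).symm
  have hγr : γ.real univ = c := by rw [Measure.real, hγm]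
  have hmass : ∀ ν ∈ EPlusOn κ A, ν.real univ ≤ mutualEnergy κ γ ν := fun ν hν =>
    hκ.real_univ_le_mutualEnergy hγ.1 hν.1 (hfin ν hν)
      (hκ.ae_of_nearlyEverywhereOn hν (hfin ν hν)
        (hκ.measurableSet_not_one_le_potential hγ.1.1) hγne)
  have hGamma : ∀ ν ∈ GammaPlus κ A, c ≤ mutualEnergy κ ν γ := fun ν hν => by
    rw [← hγr]
    exact hκ.real_univ_le_mutualEnergy hν.1 hγ.1 (hfin γ hγ)
      (hκ.ae_of_nearlyEverywhereOn hγ (hfin γ hγ)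
        (hκ.measurableSet_not_one_le_potential hν.1.1) hν.2)
  have hGamma_le : ∀ ν ∈ GammaPlus κ A, c ≤ mutualEnergy κ ν ν := fun ν hν => by
    linarith [hGamma ν hν, hκ.two_mul_mutualEnergy_le hν.1 hγ.1]
  have hG_le : ∀ ν ∈ EPlusOn κ A, 2 * ν.real univ - mutualEnergy κ ν ν ≤ c := fun ν hν => by
    linarith [hmass ν hν, hκ.two_mul_mutualEnergy_le hγ.1 hν.1]
  -- By `hmass`, `‖ν - γ‖² ≤ c - G(ν)`; hence `G(ν) ≥ c` leaves only `ν = γ`.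
  have hG_eq : ∀ ν ∈ EPlusOn κ A, c ≤ 2 * ν.real univ - mutualEnergy κ ν ν → ν = γ :=
    fun ν hν h => (hκ.energyPrinciple.eq_of_sq_nonpos hγ.1 hν.1
      (by linarith [hmass ν hν])).symm
  have hγone : ∀ᵐ x ∂γ, potential κ γ x = 1 :=
    hκ.ae_eq_one_of_one_le hγ.1 hγ.1 (hfin γ hγ)
      (hκ.ae_of_nearlyEverywhereOn hγ (hfin γ hγ)
        (hκ.measurableSet_not_one_le_potential hγ.1.1) hγne) (by rw [hγq, hγr])
  have hγle : ∀ᵐ x ∂γ, potential κ γ x ≤ 1 := hγone.mono fun x hx => hx.le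
  have hγhat : γ ∈ EHatOn κ A := ⟨hγ, hγle⟩
  have hhat : ∀ ν ∈ EHatOn κ A, mutualEnergy κ ν ν ≤ ν.real univ := fun ν hν =>
    hκ.mutualEnergy_le_real_univ hν.1.1 hν.1.1 (hfin ν hν.1) hν.2
  have hhat_le : ∀ ν ∈ EHatOn κ A, ν univ ≤ innerCap κ A := fun ν hν => by
    rw [← ENNReal.toReal_le_toReal (hfin ν hν.1) hcap.ne]
    change ν.real univ ≤ c
    linarith [hG_le ν hν.1, hhat ν hν]
  have hb : ∀ μ ∈ EPlusOn κ A, NearlyEverywhereOn κ A (fun x => 1 ≤ potential κ μ x) →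
      (∀ᵐ x ∂μ, potential κ μ x ≤ 1) → μ = γ := fun μ hμ h1 h2 => by
    refine hG_eq μ hμ ?_
    -- The two conditions give `μ(X) ≥ ‖μ‖² ≥ c`, so `G(μ) ≥ ‖μ‖² ≥ c`.
    linarith [hhat μ ⟨hμ, h2⟩, hGamma_le μ ⟨hμ.1, h1⟩]
  refine ⟨γ, fun μ => ⟨fun hμ => ?_, ?_⟩, hγhat, fun μ => ⟨fun hμ => ?_, ?_⟩, ?_,
    fun μ => ⟨fun hμ => ?_, ?_⟩, hγm, fun μ hμ => ⟨fun h => ?_, ?_⟩,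
    fun μ hμ => ⟨fun h => hb μ hμ h.1 h.2, ?_⟩, fun hF μ hμ => ⟨fun h => ?_, ?_⟩⟩
  · have hle := isMinOn_iff.1 hμ.2 γ ⟨hγ.1, hγne⟩
    rw [hκ.coe_mutualEnergy hμ.1.1 hμ.1.1, hκ.coe_mutualEnergy hγ.1 hγ.1,
      EReal.coe_le_coe_iff, hγq] at hle
    refine hκ.energyPrinciple.eq_of_sq_nonpos hμ.1.1 hγ.1 ?_
    linarith [hGamma μ hμ.1]
  · rintro rfl
    refine ⟨⟨hγ.1, hγne⟩, isMinOn_iff.2 fun ν hν => ?_⟩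
    rw [hκ.coe_mutualEnergy hν.1 hν.1, hκ.coe_mutualEnergy hγ.1 hγ.1, EReal.coe_le_coe_iff, hγq]
    exact hGamma_le ν hν
  · have hle := isMaxOn_iff.1 hμ.2 γ hγ
    rw [hκ.gaussG_eq hμ.1.1 (hfin μ hμ.1), hκ.gaussG_eq hγ.1 (hfin γ hγ),
      EReal.coe_le_coe_iff, hγq, hγr] at hle
    exact hG_eq μ hμ.1 (by linarith)
  · rintro rfl
    refine ⟨hγ, isMaxOn_iff.2 fun ν hν => ?_⟩
    rw [hκ.gaussG_eq hν.1 (hfin ν hν), hκ.gaussG_eq hγ.1 (hfin _ hγ), EReal.coe_le_coe_iff,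
      hγq, hγr]
    linarith [hG_le ν hν]
  · rw [hκ.gaussG_eq hγ.1 (hfin γ hγ), hcc, EReal.coe_eq_coe_iff, hγq, hγr]
    ring
  · have hle : γ univ ≤ μ univ := isMaxOn_iff.1 hμ.2 γ hγhat
    have hle' : c ≤ μ.real univ := by
      rw [← hγr]
      exact ENNReal.toReal_mono (hfin μ hμ.1.1) hle
    exact hG_eq μ hμ.1.1 (by linarith [hhat μ hμ.1])
  · rintro rfl
    exact ⟨hγhat, isMaxOn_iff.2 fun ν hν => (hhat_le ν hν).trans hγm.ge⟩
  · rw [hκ.coe_mutualEnergy hμ.1 hμ.1, ← EReal.coe_ennreal_toReal (hfin μ hμ), hcc,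
      EReal.coe_le_coe_iff, EReal.coe_le_coe_iff] at h
    have h1 : mutualEnergy κ μ μ ≤ μ.real univ := h.1
    exact hG_eq μ hμ (by linarith [h.2])
  · rintro rfl
    rw [hκ.coe_mutualEnergy hγ.1 hγ.1, hγm, hcc, hγq]
    exact ⟨le_rfl, le_rfl⟩
  · rintro rfl
    exact ⟨hγne, hγle⟩
  · refine hb μ hμ (h.mono fun x hx => hx.ge) ?_
    exact (hκ.ae_of_nearlyEverywhereOn hμ (hfin μ hμ)
      (hκ.measurableSet_not_potential_eq_one hμ.1.1) h).mono fun x hx => hx.le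
  · rintro rfl
    -- Frostman's principle extends `κγ ≤ 1` from the support to all of `X`, turning `κγ ≥ 1` n.e.
    -- into equality.
    have hle := hF _ hγ.1.1 (hκ.potential_le_one_of_mem_support hγ.1.1 hγle)
    exact hγne.mono fun x hx => le_antisymm (hle x) hx
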